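/- Setting. Write $\widehat\varphi(\omega)=\int_{\mathbb R}\varphi(t)e^{-it\omega}\,dt$, $\widetilde f(x)=f(-x)$, and let $\mathcal S$, $\mathcal S'$ be the Schwartz functions and the tempered distributions on $\mathbb R$, with $\langle\widehat g,\varphi\rangle=\langle g,\widehat\varphi\rangle$ for $g\in\mathcal S'$. Let $m>0$, $\lambda\ge 0$, $\beta>0$, and let $K$ be a real function on $\mathbb R$ (whose value at $0$ is irrelevant and may be infinite) such that: $K$ is even, positive off $0$ and locally integrable; $K(t)\to 0$ as $t\to\infty$ and $K$ is eventually decreasing; for every $\omega\neq0$ the improper integral $\int_0^\infty K(t)\cos(\omega t)\,dt$ converges and is positive; and either $K\in L^1(\mathbb R)$, or $K\notin L^1(\mathbb R)$ and, for some $\alpha\in(0,1)$, $\lim_{t\to\infty}t^{\alpha}K(t)$ exists in $(0,\infty)$. Put $K^+=K\,1_{[0,\infty)}$. Let $\dot W$ and $F$ be linear maps from the real Schwartz functions to the real square-integrable random variables on a probability space (no assumption is made on their correlation), with $$\mathbb E\langle\dot W,\varphi\rangle\langle\dot W,\psi\rangle=\int\varphi\psi,\qquad \mathbb E\langle F,\varphi\rangle\langle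 F,\psi\rangle=\int K(t)\,(\varphi*\widetilde\psi)(t)\,dt .$$ Let $\nu$ be a non-negative Borel measure on $\mathbb R$, absolutely continuous with respect to Lebesgue measure, with $\int(1+x^2)^{-k}\,\nu(dx)<\infty$ for some integer $k$. Let $\xi$ be a centred (jointly) Gaussian random measure with respect to $\nu$ on a probability space $\Omega$: a centred jointly Gaussian family $\xi(E)\in L^2(\Omega;\mathbb C)$, indexed by the Borel sets with $\nu(E)<\infty$, with $\mathbb E\,\xi(E_1)\overline{\xi(E_2)}=\nu(E_1\cap E_2)$. Let $\operatorname{Dom}(V)$ be the set of $g\in\mathcal S'$ for which $\widehat g$ is a function in $L^2(\nu)$, and put $\langle V,g\rangle=\int\overline{\widehat g(\omega)}\,\xi(d\omega)$ for such $g$. Assume that $V$ is a weak solution of the generalized Langevin equation $$m\,dV(t)=-\lambda V(t)\,dt-\beta\int_{-\infty}^tK(t-s)V(s)\,ds\,dt+\sqrt\beta F(t)\,dt+\sqrt{2\lambda}\,dW(t),$$ that is: for all real $\varphi,\psi\in\mathcal S$, $K^+*\varphi\in\operatorname{Dom}(V)$ and, with $L\varphi=-m\varphi'+\lambda\varphi+\beta\,\widetilde{K^+*\widetilde\varphi}$,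 $$\mathbb E\langle V,L\varphi\rangle\overline{\langle V,L\psi\rangle}=\mathbb E\langle\sqrt{2\lambda}\,\dot W+\sqrt\beta F,\varphi\rangle\langle\sqrt{2\lambda}\,\dot W+\sqrt\beta F,\psi\rangle .$$ Theorem. (i) For every $t\in\mathbb R$, $\delta_t\in\operatorname{Dom}(V)$, and the velocity $V(t)=\langle V,\delta_t\rangle$, $t\in\mathbb R$, is a centred Gaussian process that is stationary in the wide sense and mean-square continuous: $V(t)\in L^2(\Omega)$, $\mathbb E|V(t+h)-V(t)|^2\to0$ as $h\to0$, and $\mathbb E\,V(t)\overline{V(s)}$ depends only on $t-s$. (ii) $V(t)$ has an almost surely continuous version: there are random variables $\eta(t)$, $t\in\mathbb R$, with $\eta(t)=V(t)$ a.s. for every $t$, such that almost surely $t\mapsto\eta(t)$ is continuous. (iii) For every $t\ge0$, $1_{[0,t]}\in\operatorname{Dom}(V)$, and for a process $\eta$ as in (ii) the position $X(t)=\langle V,1_{[0,t]}\rangle$ equals $\int_0^t\eta(s)\,ds$ a.s. Almost surely $t\mapsto\int_0^t\eta(s)\,ds$ is differentiable at every $t$, with derivative $\eta(t)$. Thus the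 position has an almost surely differentiable version. -/

import Mathlib

open MeasureTheory ProbabilityTheory Filter Set
open scoped Topology SchwartzMap FourierTransform ComplexConjugate ENNReal

noncomputable section

namespace GLE

/-! ### Fourier transform of tempered distributions, with kernel `exp (-i t ω)` -/

/-- The dilation `ω ↦ ω / (2π)` of the real line. -/
def dilation : ℝ ≃L[ℝ] ℝ :=
  ContinuousLinearEquiv.smulLeft (Units.mk0 ((2 * Real.pi)⁻¹) (by positivity) : ℝˣ)

/-- The Fourier transform `φ̂(ω) = ∫ φ(t) exp (-i t ω) dt` of Schwartz functions. Mathlib's `𝓕` uses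
the kernel `exp (-2π i t ω)`, so that `φ̂(ω) = 𝓕 φ (ω / 2π)`. -/
def fourierS : 𝓢(ℝ, ℂ) →L[ℂ] 𝓢(ℝ, ℂ) :=
  (SchwartzMap.compCLMOfContinuousLinearEquiv ℂ dilation) ∘L
    (FourierTransform.fourierCLM ℂ 𝓢(ℝ, ℂ))

theorem fourierS_apply (φ : 𝓢(ℝ, ℂ)) (ω : ℝ) :
    fourierS φ ω = ∫ t : ℝ, φ t * Complex.exp (-(Complex.I * t * ω)) := by
  have h1 : fourierS φ ω = 𝓕 (φ : ℝ → ℂ) ((2 * Real.pi)⁻¹ * ω) := rfl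
  rw [h1, Real.fourier_eq']
  refine integral_congr_ae (Eventually.of_forall fun t => ?_)
  have hpi : (Real.pi : ℂ) ≠ 0 := by exact_mod_cast Real.pi_ne_zero
  simp only [smul_eq_mul, mul_comm (φ t)]
  congr 2
  simp
  field_simp

/-- The Fourier transform of a tempered distribution: `⟨ĝ, φ⟩ = ⟨g, φ̂⟩`. -/
def fourierD (g : 𝓢'(ℝ, ℂ)) : 𝓢'(ℝ, ℂ) :=
  PointwiseConvergenceCLM.precomp ℂ fourierS g

theorem fourierD_apply (g : 𝓢'(ℝ, ℂ)) (φ : 𝓢(ℝ, ℂ)) : fourierD g φ = g (fourierS φ) := rfl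

/-- The tempered distribution `g` is the function `f`. -/
def Represents (g : 𝓢'(ℝ, ℂ)) (f : ℝ → ℂ) : Prop :=
  ∀ φ : 𝓢(ℝ, ℂ), Integrable (fun x => f x * φ x) ∧ g φ = ∫ x, f x * φ x

/-- A function representing a tempered distribution is unique up to null sets. -/
theorem Represents.ae_eq {g : 𝓢'(ℝ, ℂ)} {f₁ f₂ : ℝ → ℂ} (h₁ : Represents g f₁)
    (h₂ : Represents g f₂) : f₁ =ᵐ[volume] f₂ := by
  have key : ∀ (u : ℝ → ℝ) (hu : ContDiff ℝ ((⊤ : ℕ∞) : WithTop ℕ∞) u) (hc : HasCompactSupport u),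
      ∃ φ : 𝓢(ℝ, ℂ), ∀ x, φ x = (u x : ℂ) := by
    intro u hu hc
    have hg₁ : HasCompactSupport (Complex.ofRealCLM ∘ u) := hc.comp_left rfl
    have hg₂ : ContDiff ℝ ((⊤ : ℕ∞) : WithTop ℕ∞) (Complex.ofRealCLM ∘ u) :=
      Complex.ofRealCLM.contDiff.comp hu
    exact ⟨hg₁.toSchwartzMap hg₂, fun x => rfl⟩
  have loc : ∀ {f : ℝ → ℂ}, Represents g f → LocallyIntegrable f volume := by
    intro f hf x
    let b : ContDiffBump x := ⟨1, 2, one_pos, one_lt_two⟩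
    obtain ⟨φ, hφ⟩ := key b b.contDiff b.hasCompactSupport
    refine ⟨Metric.closedBall x 1, Metric.closedBall_mem_nhds x one_pos, ?_⟩
    refine ((hf φ).1.integrableOn (s := Metric.closedBall x 1)).congr_fun ?_
      measurableSet_closedBall
    intro y hy
    have : b y = 1 := b.one_of_mem_closedBall hy
    simp [hφ, this]
  refine ae_eq_of_integral_contDiff_smul_eq (loc h₁) (loc h₂) fun u hu hc => ?_
  obtain ⟨φ, hφ⟩ := key u hu hc
  have e := (h₁ φ).2.symm.trans (h₂ φ).2
  simp only [hφ] at e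
  simpa only [Complex.real_smul, mul_comm] using e

open Classical in
/-- The tempered distribution `φ ↦ ∫ u(x) φ(x) dx` given by a function `u` (`0` if `u` does not
define one). -/
def funDist (u : ℝ → ℂ) : 𝓢'(ℝ, ℂ) :=
  if h : ∃ g : 𝓢'(ℝ, ℂ), Represents g u then h.choose else 0

theorem represents_funDist {u : ℝ → ℂ} (h : ∃ g : 𝓢'(ℝ, ℂ), Represents g u) :
    Represents (funDist u) u := by
  unfold funDist
  rw [dif_pos h]
  exact h.choose_spec

/-- Bounded measurable functions define tempered distributions. -/
theorem represents_funDist_of_memLp_top {u : ℝ → ℂ} (hu : MemLp u ∞ volume) :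
    Represents (funDist u) u := by
  refine represents_funDist ⟨Lp.toTemperedDistribution (hu.toLp u), fun φ => ⟨?_, ?_⟩⟩
  · have hb : ∀ᵐ x, ‖u x‖ ≤ (eLpNormEssSup u volume).toReal := by
      filter_upwards [ae_le_eLpNormEssSup (f := u) (μ := volume)] with x hx
      have hfin : eLpNormEssSup u volume ≠ ∞ := by
        rw [← eLpNorm_exponent_top]; exact hu.eLpNorm_ne_top
      simpa using ENNReal.toReal_mono hfin hx
    exact φ.integrable.bdd_mul hu.aestronglyMeasurable hb
  · rw [Lp.toTemperedDistribution_apply]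
    refine integral_congr_ae ?_
    filter_upwards [hu.coeFn_toLp] with x hx
    rw [hx, smul_eq_mul, mul_comm]

/-! ### Gaussian random measures and the stochastic integral -/

variable {Ω : Type*} [MeasurableSpace Ω]

/-- The Borel sets of finite `ν`-measure. -/
abbrev FiniteBorel (ν : Measure ℝ) : Type := {E : Set ℝ // MeasurableSet E ∧ ν E < ∞}

/-- A centred Gaussian random measure with respect to `ν`: a jointly Gaussian family
`ξ(E) ∈ L²(Ω; ℂ)`, indexed by the Borel sets of finite `ν`-measure, with
`𝔼[ξ(E₁) conj ξ(E₂)] = ν(E₁ ∩ E₂)`. -/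
structure GaussianRandomMeasure (ν : Measure ℝ) (P : Measure Ω) where
  toFun : FiniteBorel ν → Lp ℂ 2 P
  cov : ∀ E₁ E₂ : FiniteBorel ν,
    ∫ x, toFun E₁ x * conj (toFun E₂ x) ∂P = ((ν.real (E₁.1 ∩ E₂.1) : ℝ) : ℂ)
  mean_zero : ∀ E : FiniteBorel ν, ∫ x, toFun E x ∂P = 0
  gaussian : IsGaussianProcess (fun (E : FiniteBorel ν) (x : Ω) => toFun E x) P

namespace GaussianRandomMeasure

variable {ν : Measure ℝ} {P : Measure Ω}

/-- `∑ cᵢ Eᵢ ↦ ∑ cᵢ 1_{Eᵢ} ∈ L²(ν)`. -/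
def simpleFun (ν : Measure ℝ) : (FiniteBorel ν →₀ ℂ) →ₗ[ℂ] Lp ℂ 2 ν :=
  Finsupp.linearCombination ℂ fun E : FiniteBorel ν => indicatorConstLp 2 E.2.1 E.2.2.ne (1 : ℂ)

/-- `∑ cᵢ Eᵢ ↦ ∑ cᵢ ξ(Eᵢ) ∈ L²(Ω)`. -/
def simpleInt (ξ : GaussianRandomMeasure ν P) : (FiniteBorel ν →₀ ℂ) →ₗ[ℂ] Lp ℂ 2 P :=
  Finsupp.linearCombination ℂ ξ.toFun

/-- The stochastic integral `g ↦ ∫ g dξ`, the continuous extension to `L²(ν)` of the map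
`∑ cᵢ 1_{Eᵢ} ↦ ∑ cᵢ ξ(Eᵢ)`. -/
def integral (ξ : GaussianRandomMeasure ν P) : Lp ℂ 2 ν →L[ℂ] Lp ℂ 2 P :=
  ξ.simpleInt.extendOfNorm (simpleFun ν)

theorem denseRange_simpleFun (ν : Measure ℝ) : DenseRange (simpleFun ν) := by
  intro f
  have : f ∈ (LinearMap.range (simpleFun ν)).topologicalClosure := by
    refine Lp.induction (p := 2) (by norm_num)
      (motive := fun f => f ∈ (LinearMap.range (simpleFun ν)).topologicalClosure) ?_ ?_ ?_ f
    · intro c s hs hμs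
      refine Submodule.le_topologicalClosure _ ⟨Finsupp.single ⟨s, hs, hμs⟩ c, ?_⟩
      rw [simpleFun, Finsupp.linearCombination_single, Lp.simpleFunc.coe_indicatorConst]
      ext1
      filter_upwards [Lp.coeFn_smul c (indicatorConstLp 2 hs hμs.ne (1 : ℂ)),
        indicatorConstLp_coeFn (p := 2) (hs := hs) (hμs := hμs.ne) (c := (1 : ℂ)),
        indicatorConstLp_coeFn (p := 2) (hs := hs) (hμs := hμs.ne) (c := c)] with x h1 h2 h3
      rw [h1, h3, Pi.smul_apply, h2]
      by_cases hx : x ∈ s <;> simp [hx]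
    · intro f g hf hg _ h1 h2
      exact Submodule.add_mem _ h1 h2
    · exact Submodule.isClosed_topologicalClosure _
  exact this

theorem norm_simpleInt (ξ : GaussianRandomMeasure ν P) (a : FiniteBorel ν →₀ ℂ) :
    ‖ξ.simpleInt a‖ = ‖simpleFun ν a‖ := by
  have hin : ∀ E₁ E₂ : FiniteBorel ν, inner ℂ (ξ.toFun E₁) (ξ.toFun E₂) =
      inner ℂ (indicatorConstLp 2 E₁.2.1 E₁.2.2.ne (1 : ℂ))
        (indicatorConstLp 2 E₂.2.1 E₂.2.2.ne (1 : ℂ)) := by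
    intro E₁ E₂
    rw [L2.inner_indicatorConstLp_one_indicatorConstLp_one E₁.2.1 E₂.2.1 E₁.2.2.ne E₂.2.2.ne,
      L2.inner_def, inter_comm]
    exact ξ.cov E₂ E₁
  have h2 : inner ℂ (ξ.simpleInt a) (ξ.simpleInt a)
      = inner ℂ (simpleFun ν a) (simpleFun ν a) := by
    simp only [simpleInt, simpleFun, Finsupp.linearCombination_apply, Finsupp.sum, sum_inner,
      inner_sum, inner_smul_left, inner_smul_right, hin]
  rw [inner_self_eq_norm_sq_to_K, inner_self_eq_norm_sq_to_K] at h2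
  have h3 : ‖ξ.simpleInt a‖ ^ 2 = ‖simpleFun ν a‖ ^ 2 := by exact_mod_cast h2
  exact (sq_eq_sq₀ (norm_nonneg _) (norm_nonneg _)).1 h3

theorem integral_indicator (ξ : GaussianRandomMeasure ν P) (E : FiniteBorel ν) :
    ξ.integral (indicatorConstLp 2 E.2.1 E.2.2.ne (1 : ℂ)) = ξ.toFun E := by
  have h := LinearMap.extendOfNorm_eq (f := ξ.simpleInt) (e := simpleFun ν)
    (denseRange_simpleFun ν) ⟨1, fun x => by rw [ξ.norm_simpleInt, one_mul]⟩
    (Finsupp.single E 1)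
  simpa [simpleFun, simpleInt, integral] using h

theorem norm_integral (ξ : GaussianRandomMeasure ν P) (g : Lp ℂ 2 ν) :
    ‖ξ.integral g‖ = ‖g‖ := by
  refine (denseRange_simpleFun ν).induction_on (p := fun g => ‖ξ.integral g‖ = ‖g‖) g
    (isClosed_eq (by fun_prop) (by fun_prop)) fun a => ?_
  rw [integral, LinearMap.extendOfNorm_eq (denseRange_simpleFun ν)
    ⟨1, fun x => by rw [ξ.norm_simpleInt, one_mul]⟩, ξ.norm_simpleInt]

end GaussianRandomMeasure

/-! ### Stationary random distributions extended to tempered distributions -/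

/-- The data of an extended stationary random distribution: an absolutely continuous spectral
measure of polynomial growth and a Gaussian random measure with respect to it. -/
structure ExtendedDistribution (P : Measure Ω) where
  ν : Measure ℝ
  growth : ∃ k : ℕ, Integrable (fun x : ℝ => ((1 + x ^ 2) ^ k)⁻¹) ν
  absCont : ν ≪ volume
  ξ : GaussianRandomMeasure ν P

namespace ExtendedDistribution

variable {P : Measure Ω}

/-- The domain: those `g ∈ 𝓢'` whose Fourier transform is a function that lies in `L²(ν)`. -/
def Dom (V : ExtendedDistribution P) : Set 𝓢'(ℝ, ℂ) :=
  {g | ∃ f : ℝ → ℂ, Represents (fourierD g) f ∧ MemLp f 2 V.ν}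

open Classical in
/-- `⟨V, g⟩ = ∫ conj (ĝ(ω)) ξ(dω)` for `g` in the domain (and `0` outside it). -/
def pair (V : ExtendedDistribution P) (g : 𝓢'(ℝ, ℂ)) : Lp ℂ 2 P :=
  if h : g ∈ V.Dom then V.ξ.integral (h.choose_spec.2.star.toLp (star h.choose)) else 0

/-- The value of `⟨V, g⟩` does not depend on the function chosen to represent `ĝ`. -/
theorem pair_eq (V : ExtendedDistribution P) {g : 𝓢'(ℝ, ℂ)} {f : ℝ → ℂ}
    (hf : Represents (fourierD g) f) (hf2 : MemLp f 2 V.ν) :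
    V.pair g = V.ξ.integral (hf2.star.toLp (star f)) := by
  have h : g ∈ V.Dom := ⟨f, hf, hf2⟩
  unfold pair
  rw [dif_pos h]
  congr 1
  refine (MemLp.toLp_eq_toLp_iff _ _).2 ?_
  filter_upwards [V.absCont.ae_eq (h.choose_spec.1.ae_eq hf)] with x hx
  simp [hx]

/-- The velocity `V(t) = ⟨V, δ_t⟩`. -/
def velocity (V : ExtendedDistribution P) (t : ℝ) : Lp ℂ 2 P :=
  V.pair (TemperedDistribution.delta t)

/-- The tempered distribution `1_{[0,t]}`. -/
def intervalDist (t : ℝ) : 𝓢'(ℝ, ℂ) := funDist ((Icc 0 t).indicator fun _ => 1)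

/-- The position `X(t) = ⟨V, 1_{[0,t]}⟩`, for `t ≥ 0`. -/
def position (V : ExtendedDistribution P) (t : ℝ) : Lp ℂ 2 P :=
  V.pair (intervalDist t)

end ExtendedDistribution

/-! ### Memory kernels, noises, weak solutions -/

/-- Admissible memory kernels. The value of `K` at `0` is immaterial, which accounts for kernels
that are infinite there. -/
structure IsAdmissibleKernel (K : ℝ → ℝ) : Prop where
  symm : ∀ t, t ≠ 0 → K (-t) = K t
  pos : ∀ t, t ≠ 0 → 0 < K t
  tendsto_zero : Tendsto K atTop (𝓝 0)
  eventually_decreasing : ∃ A : ℝ, AntitoneOn K (Ici A)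
  locallyIntegrable : LocallyIntegrable K volume
  /-- The improper integral `∫_0^∞ K(t) cos(ω t) dt` converges and is positive. -/
  cos_pos : ∀ ω : ℝ, ω ≠ 0 → ∃ L : ℝ, 0 < L ∧
    Tendsto (fun R : ℝ => ∫ t in (0 : ℝ)..R, K t * Real.cos (ω * t)) atTop (𝓝 L)
  tail : Integrable K volume ∨
    (¬ Integrable K volume ∧ ∃ α : ℝ, 0 < α ∧ α < 1 ∧ ∃ C : ℝ, 0 < C ∧
      Tendsto (fun t : ℝ => K t / t ^ (-α)) atTop (𝓝 C))

/-- The convolution `(f * g)(t) = ∫ f(s) g(t - s) ds`. -/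
def conv (f g : ℝ → ℝ) (t : ℝ) : ℝ := ∫ s, f s * g (t - s)

/-- The reflection `f̃(x) = f(-x)`. -/
def refl (f : ℝ → ℝ) (x : ℝ) : ℝ := f (-x)

/-- `K⁺(t) = K(t) 1_{t ≥ 0}`. -/
def plus (K : ℝ → ℝ) : ℝ → ℝ := (Ici (0 : ℝ)).indicator K

/-- The function `-m φ' + λ φ + β (K⁺ * φ̃)~` that the velocity is tested against. -/
def testOp (m lam β : ℝ) (K φ : ℝ → ℝ) (t : ℝ) : ℝ :=
  -m * deriv φ t + lam * φ t + β * refl (conv (plus K) (refl φ)) t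

/-- White noise: a random distribution with `𝔼[⟨W, φ⟩⟨W, ψ⟩] = ∫ φ ψ`. -/
def IsWhiteNoise {P : Measure Ω} (W : 𝓢(ℝ, ℝ) →ₗ[ℝ] Lp ℝ 2 P) : Prop :=
  ∀ φ ψ : 𝓢(ℝ, ℝ), ∫ x, W φ x * W ψ x ∂P = ∫ t, φ t * ψ t

/-- A random distribution with covariance distribution `K`:
`𝔼[⟨F, φ⟩⟨F, ψ⟩] = ∫ K(t) (φ * ψ̃)(t) dt`. -/
def HasCovarianceKernel {P : Measure Ω} (K : ℝ → ℝ) (F : 𝓢(ℝ, ℝ) →ₗ[ℝ] Lp ℝ 2 P) : Prop :=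
  ∀ φ ψ : 𝓢(ℝ, ℝ), ∫ x, F φ x * F ψ x ∂P = ∫ t, K t * conv φ (refl ψ) t

/-- `V` is a weak solution of the generalized Langevin equation with parameters `m, λ, β`, memory
kernel `K` and noises `W, F`. The noises may live on another probability space than `V`. -/
structure IsWeakSolution {Ω' : Type*} [MeasurableSpace Ω'] {P : Measure Ω} {P' : Measure Ω'}
    (m lam β : ℝ) (K : ℝ → ℝ) (W F : 𝓢(ℝ, ℝ) →ₗ[ℝ] Lp ℝ 2 P')
    (V : ExtendedDistribution P) : Prop where
  conv_mem_dom : ∀ φ : 𝓢(ℝ, ℝ), funDist (fun t => (conv (plus K) φ t : ℂ)) ∈ V.Dom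
  cov_eq : ∀ φ ψ : 𝓢(ℝ, ℝ),
    ∫ x, V.pair (funDist fun t => (testOp m lam β K φ t : ℂ)) x *
        conj (V.pair (funDist fun t => (testOp m lam β K ψ t : ℂ)) x) ∂P =
      ((∫ x, (√(2 * lam) * W φ x + √β * F φ x) * (√(2 * lam) * W ψ x + √β * F ψ x) ∂P' : ℝ) : ℂ)

/-! ### Stationary processes -/

/-- Mean-square continuous processes that are stationary in the wide sense. -/
structure IsStationaryProcess (Y : ℝ → Ω → ℂ) (P : Measure Ω) : Prop where
  memLp : ∀ t, MemLp (Y t) 2 P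
  continuous : ∀ t, Tendsto (fun h : ℝ => ∫ x, ‖Y (t + h) x - Y t x‖ ^ 2 ∂P) (𝓝 0) (𝓝 0)
  mean : ∃ a : ℂ, ∀ t, ∫ x, Y t x ∂P = a
  cov : ∃ r : ℝ → ℂ, ∀ t s, ∫ x, Y t x * conj (Y s x) ∂P = r (t - s)

end GLE

end

/-!
The covariance of a stationary random distribution is the Fourier transform of its spectral measure
`ν`, so everything reduces to the decay of `ν`. If `ν` is finite, the Fourier transforms
`exp (-i t ω)` of `δ_t` and `∫ s in 0..t, exp (-i s ω)` of `1_{[0,t]}` are bounded, hence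
square-integrable, and the velocity `V(t) = ∫ exp (i t ω) ξ(dω)` is a stationary centred Gaussian
process. If moreover `∫ (1 + ω²)^(1/4) dν < ∞`, its increments have variance `O(|t - s|^(1/2))`.
They are Gaussian, so their eighth moments are `O(|t - s|²)`, and Kolmogorov's criterion
(`exists_continuous_modification`) gives a continuous version. The Riemann sums of `V` converge to
the position in `L²` and those of the continuous version converge to its integral pointwise
(`integral_eq_position`), so the position is the integral of a continuous function.

The moment bound (`integrable_one_add_sq_rpow`) is where the equation enters. For a test function
`φ` with Fourier transform `v`, the equation equates `∫ |-i m ω + λ + β k(ω)|² |v|² dν`, where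
`k(ω) = ∫ s in 0..∞, K(s) exp (i s ω)`, with the variance of the noise at `φ`. The white noise
contributes a multiple of `∫ v²`, the coloured noise one of `∫ Re k(ω) v²`, and their unknown
correlation costs a factor `2`. As `K` eventually decreases to `0`, shifting the variable by half a
period shows that `k` exists and is bounded on `|ω| ≥ 1` (`exists_isHalfLineTransform`); a
singularity at `ω = 0` is irrelevant, as only `v` supported at high frequencies is used. There the
inertial term `m ω` dominates the symbol, and therefore `∫ ω² v² dν ≤ C ∫ v²`
(`exists_integral_sq_mul_le`). Cutoffs of `v(ω) = (1 + ω²)^(-3/8)` turn this into a bound of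
`∫ (1 + ω²)^(1/4) dν` at high frequencies; low frequencies have finite measure by the growth
condition on `ν`.
-/

namespace GLE

/-! ### Continuous modifications: the Kolmogorov criterion on the line -/

section Kolmogorov

variable {E : Type*} [MetricSpace E]

/-- The largest dyadic number of level `n` that does not exceed `t`. -/
noncomputable def dyadicFloor (n : ℕ) (t : ℝ) : ℝ := ⌊(2 : ℝ) ^ n * t⌋ / 2 ^ n

theorem tendsto_dyadicFloor (t : ℝ) : Tendsto (fun n => dyadicFloor n t) atTop (𝓝 t) := by
  have h0 : Tendsto (fun n : ℕ => t - (1 / 2 : ℝ) ^ n) atTop (𝓝 (t - 0)) :=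
    tendsto_const_nhds.sub (tendsto_pow_atTop_nhds_zero_of_lt_one (by norm_num) (by norm_num))
  rw [sub_zero] at h0
  refine tendsto_of_tendsto_of_tendsto_of_le_of_le h0 tendsto_const_nhds (fun n => ?_) fun n => ?_
  · have h := Int.lt_floor_add_one ((2 : ℝ) ^ n * t)
    have hp : (0 : ℝ) < 2 ^ n := by positivity
    simp only [dyadicFloor]
    rw [le_div_iff₀ hp, sub_mul, ← mul_pow]
    norm_num
    linarith
  · have h := Int.floor_le ((2 : ℝ) ^ n * t)
    have hp : (0 : ℝ) < 2 ^ n := by positivity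
    simp only [dyadicFloor]
    rw [div_le_iff₀ hp]
    linarith

theorem abs_floor_two_pow_mul_le {N : ℕ} {t : ℝ} (ht : |t| ≤ N) (n : ℕ) :
    |⌊(2 : ℝ) ^ n * t⌋| ≤ (N : ℤ) * 2 ^ n := by
  have hp : (0 : ℝ) < 2 ^ n := by positivity
  rw [abs_le] at ht ⊢
  constructor
  · rw [Int.le_floor]
    push_cast
    nlinarith
  · have := Int.floor_le ((2 : ℝ) ^ n * t)
    have h2 : (⌊(2 : ℝ) ^ n * t⌋ : ℝ) ≤ ((N : ℤ) * 2 ^ n : ℤ) := by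
      push_cast
      nlinarith
    exact_mod_cast h2

/-- Consecutive dyadic approximations of `t` agree or are neighbours on the finer grid. -/
theorem dist_dyadicFloor_succ_le {f : ℝ → E} {δ : ℕ → ℝ} {N : ℕ}
    (h : ∀ n, ∀ k : ℤ, |k| ≤ N * 2 ^ n → dist (f (k / 2 ^ n)) (f ((k + 1) / 2 ^ n)) ≤ δ n)
    {t : ℝ} (ht : |t| ≤ N) (n : ℕ) :
    dist (f (dyadicFloor n t)) (f (dyadicFloor (n + 1) t)) ≤ δ (n + 1) := by
  have hk := abs_floor_two_pow_mul_le ht n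
  set k := ⌊(2 : ℝ) ^ n * t⌋ with hkdef
  have e1 : dyadicFloor n t = ((2 * k : ℤ) : ℝ) / 2 ^ (n + 1) := by
    simp only [dyadicFloor, ← hkdef]
    push_cast
    rw [pow_succ]
    field_simp
  have hk2 : |2 * k| ≤ (N : ℤ) * 2 ^ (n + 1) := by
    rw [abs_mul, pow_succ]
    norm_num
    linarith
  have h2 := h (n + 1) (2 * k) hk2
  have hl : 2 * k ≤ ⌊(2 : ℝ) ^ (n + 1) * t⌋ := by
    rw [Int.le_floor]
    have := Int.floor_le ((2 : ℝ) ^ n * t)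
    rw [← hkdef] at this
    push_cast
    rw [pow_succ]
    linarith
  have hu : ⌊(2 : ℝ) ^ (n + 1) * t⌋ < 2 * k + 2 := by
    rw [Int.floor_lt]
    have := Int.lt_floor_add_one ((2 : ℝ) ^ n * t)
    rw [← hkdef] at this
    push_cast
    rw [pow_succ]
    linarith
  rcases (by omega : ⌊(2 : ℝ) ^ (n + 1) * t⌋ = 2 * k ∨ ⌊(2 : ℝ) ^ (n + 1) * t⌋ = 2 * k + 1)
    with h3 | h3
  · have e2 : dyadicFloor (n + 1) t = dyadicFloor n t := by
      rw [e1, dyadicFloor, h3]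
    rw [e2, dist_self]
    exact dist_nonneg.trans h2
  · have e2 : dyadicFloor (n + 1) t = (((2 * k : ℤ) : ℝ) + 1) / 2 ^ (n + 1) := by
      rw [dyadicFloor, h3]
      push_cast
      ring
    rw [e1, e2]
    exact h2

theorem dist_dyadicFloor_le_of_abs_sub_lt {f : ℝ → E} {δ : ℕ → ℝ} {N : ℕ}
    (h : ∀ n, ∀ k : ℤ, |k| ≤ N * 2 ^ n → dist (f (k / 2 ^ n)) (f ((k + 1) / 2 ^ n)) ≤ δ n)
    {s t : ℝ} (hs : |s| ≤ N) (ht : |t| ≤ N) {n : ℕ} (hst : |s - t| < (1 / 2) ^ n) :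
    dist (f (dyadicFloor n s)) (f (dyadicFloor n t)) ≤ δ n := by
  wlog hle : s ≤ t generalizing s t
  · rw [dist_comm]
    exact this ht hs (by rwa [abs_sub_comm]) (le_of_not_ge hle)
  have hp : (0 : ℝ) < 2 ^ n := by positivity
  have hk := abs_floor_two_pow_mul_le hs n
  have h2 := h n _ hk
  have hl : ⌊(2 : ℝ) ^ n * s⌋ ≤ ⌊(2 : ℝ) ^ n * t⌋ := Int.floor_le_floor (by gcongr)
  have hu : ⌊(2 : ℝ) ^ n * t⌋ < ⌊(2 : ℝ) ^ n * s⌋ + 2 := by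
    rw [Int.floor_lt]
    have h3 := Int.lt_floor_add_one ((2 : ℝ) ^ n * s)
    have h4 : 2 ^ n * (t - s) < 1 := by
      rw [abs_sub_comm, abs_of_nonneg (by linarith), div_pow, one_pow, lt_div_iff₀ hp] at hst
      linarith
    push_cast
    linarith
  rcases (by omega : ⌊(2 : ℝ) ^ n * t⌋ = ⌊(2 : ℝ) ^ n * s⌋ ∨
    ⌊(2 : ℝ) ^ n * t⌋ = ⌊(2 : ℝ) ^ n * s⌋ + 1) with h3 | h3
  · rw [dyadicFloor, dyadicFloor, h3, dist_self]
    exact dist_nonneg.trans h2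
  · rw [dyadicFloor, dyadicFloor, h3]
    push_cast
    exact h2

/-- If the increments of `f` over neighbouring dyadic numbers of level `n` are, locally uniformly,
bounded by the terms of a convergent series, then `f` has a continuous extension from the dyadic
numbers: the dyadic step functions converge locally uniformly, and their jumps tend to `0`. -/
theorem exists_continuous_of_dyadic_increments [CompleteSpace E] {f : ℝ → E}
    (h : ∀ N : ℕ, ∃ δ : ℕ → ℝ, Summable δ ∧ ∀ n, ∀ k : ℤ, |k| ≤ N * 2 ^ n →
      dist (f (k / 2 ^ n)) (f ((k + 1) / 2 ^ n)) ≤ δ n) :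
    ∃ g : ℝ → E, Continuous g ∧ ∀ t, Tendsto (fun n => f (dyadicFloor n t)) atTop (𝓝 (g t)) := by
  have hlim : ∀ t : ℝ, ∃ y, Tendsto (fun n => f (dyadicFloor n t)) atTop (𝓝 y) := by
    intro t
    obtain ⟨N, hN⟩ := exists_nat_ge |t|
    obtain ⟨δ, hδ, hf⟩ := h N
    exact cauchySeq_tendsto_of_complete (cauchySeq_of_dist_le_of_summable (fun n => δ (n + 1))
      (fun n => dist_dyadicFloor_succ_le hf hN n) ((summable_nat_add_iff 1).2 hδ))
  choose g hg using hlim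
  refine ⟨g, continuous_iff_continuousAt.2 fun t => ?_, hg⟩
  obtain ⟨N, hN⟩ := exists_nat_ge (|t| + 1)
  obtain ⟨δ, hδ, hf⟩ := h N
  have hδ1 : Summable fun n => δ (n + 1) := (summable_nat_add_iff 1).2 hδ
  have htail : ∀ s : ℝ, |s| ≤ N → ∀ n,
      dist (f (dyadicFloor n s)) (g s) ≤ ∑' m, δ (m + n + 1) := by
    intro s hs n
    have := dist_le_tsum_of_dist_le_of_tendsto (fun n => δ (n + 1))
      (fun n => dist_dyadicFloor_succ_le hf hs n) hδ1 (hg s) n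
    simpa [add_comm] using this
  rw [Metric.continuousAt_iff]
  intro ε hε
  have h1 : ∀ᶠ n in atTop, ∑' m, δ (m + n + 1) < ε / 3 :=
    (tendsto_sum_nat_add fun n => δ (n + 1)).eventually (gt_mem_nhds (by positivity))
  have h2 : ∀ᶠ n in atTop, δ n < ε / 3 :=
    hδ.tendsto_atTop_zero.eventually (gt_mem_nhds (by positivity))
  obtain ⟨n, hn1, hn2⟩ := (h1.and h2).exists
  refine ⟨(1 / 2) ^ n, by positivity, fun {s} hs => ?_⟩
  rw [Real.dist_eq] at hs
  have hs1 : |s| ≤ N := by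
    have h3 : |s - t| < 1 := hs.trans_le (pow_le_one₀ (by norm_num) (by norm_num))
    have h4 := abs_sub_abs_le_abs_sub s t
    linarith
  have ht1 : |t| ≤ N := by linarith
  have h5 := htail s hs1 n
  have h6 := htail t ht1 n
  have h7 := dist_dyadicFloor_le_of_abs_sub_lt hf hs1 ht1 hs
  have h8 := dist_triangle4 (g s) (f (dyadicFloor n s)) (f (dyadicFloor n t)) (g t)
  rw [dist_comm (g s) (f (dyadicFloor n s))] at h8
  linarith

variable {Ω : Type*} {mΩ : MeasurableSpace Ω} {P : Measure Ω}

/-- The dyadic increments of a process satisfying the Kolmogorov condition are almost surely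
geometrically small: the weighted sum of all their `p`-th powers has finite expectation. -/
theorem ae_dyadic_increments_le {p q : ℝ} {M : NNReal} {X : ℝ → Ω → E}
    (hX : IsKolmogorovProcess X P p q M) (hq : 1 < q) (N : ℕ) :
    ∀ᵐ x ∂P, ∃ δ : ℕ → ℝ, Summable δ ∧ ∀ n, ∀ k : ℤ, |k| ≤ N * 2 ^ n →
      dist (X (k / 2 ^ n) x) (X ((k + 1) / 2 ^ n) x) ≤ δ n := by
  -- level `n` has `O(2 ^ n)` increments of `p`-th moment `O(2 ^ (-q n))`, which leaves room for a
  -- weight `2 ^ (b n)` with `0 < b < q - 1`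
  set b : ℝ := (q - 1) / 2 with hb
  have hb0 : 0 < b := by rw [hb]; linarith
  have hp := hX.p_pos
  -- the grid points of level `n` in `[-N, N]`
  let G : ℕ → Finset ℤ := fun n => Finset.Icc (-(N * 2 ^ n)) (N * 2 ^ n)
  let S : Ω → ℝ≥0∞ := fun x => ∑' n : ℕ, ∑ k ∈ G n,
    (2 : ℝ≥0∞) ^ (b * n) * edist (X (k / 2 ^ n) x) (X ((k + 1) / 2 ^ n) x) ^ p
  have hmeas : ∀ (n : ℕ) (k : ℤ), Measurable fun x =>
      edist (X (k / 2 ^ n) x) (X ((k + 1) / 2 ^ n) x) ^ p := fun n k =>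
    hX.measurable_edist.pow_const p
  have hcard : ∀ n, ((G n).card : ℝ≥0∞) ≤ (2 * N + 1) * 2 ^ n := by
    intro n
    have h1 : (G n).card ≤ (2 * N + 1) * 2 ^ n := by
      simp only [G, Int.card_Icc]
      have : (1 : ℤ) ≤ 2 ^ n := one_le_pow₀ (by norm_num)
      have h2 : ((N : ℤ) * 2 ^ n + 1 - -(N * 2 ^ n)) ≤ ((2 * N + 1) * 2 ^ n : ℕ) := by
        push_cast
        linarith
      exact Int.toNat_le.2 h2
    calc ((G n).card : ℝ≥0∞) ≤ (((2 * N + 1) * 2 ^ n : ℕ) : ℝ≥0∞) := by exact_mod_cast h1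
      _ = _ := by push_cast; ring
  have hterm : ∀ n : ℕ, ∫⁻ x, ∑ k ∈ G n, (2 : ℝ≥0∞) ^ (b * n) *
      edist (X (k / 2 ^ n) x) (X ((k + 1) / 2 ^ n) x) ^ p ∂P
      ≤ ((2 * N + 1) * M) * ((2 : ℝ≥0∞) ^ (-b)) ^ n := by
    intro n
    rw [lintegral_finsetSum _ fun k _ => (hmeas n k).const_mul _]
    have h1 : ∀ k ∈ G n, ∫⁻ x, (2 : ℝ≥0∞) ^ (b * n) *
        edist (X (k / 2 ^ n) x) (X ((k + 1) / 2 ^ n) x) ^ p ∂P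
        ≤ (2 : ℝ≥0∞) ^ (b * n) * (M * (2 : ℝ≥0∞) ^ (-(n * q))) := by
      intro k _
      rw [lintegral_const_mul _ (hmeas n k)]
      gcongr
      refine (hX.kolmogorovCondition _ _).trans_eq ?_
      congr 1
      rw [edist_dist, Real.dist_eq]
      have : |(k : ℝ) / 2 ^ n - (k + 1) / 2 ^ n| = (2 ^ n)⁻¹ := by
        rw [← sub_div, sub_add_cancel_left, abs_div, abs_neg, abs_one, abs_of_pos (by positivity),
          one_div]
      rw [this, ENNReal.ofReal_inv_of_pos (by positivity), ENNReal.ofReal_pow (by norm_num),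
        ENNReal.inv_rpow, ENNReal.rpow_neg, ENNReal.rpow_mul, ENNReal.rpow_natCast]
      norm_num
    refine (Finset.sum_le_sum h1).trans ?_
    rw [Finset.sum_const, nsmul_eq_mul]
    calc ((G n).card : ℝ≥0∞) * ((2 : ℝ≥0∞) ^ (b * n) * (M * (2 : ℝ≥0∞) ^ (-(n * q))))
        ≤ ((2 * N + 1) * 2 ^ n) * ((2 : ℝ≥0∞) ^ (b * n) * (M * (2 : ℝ≥0∞) ^ (-(n * q)))) := by
          gcongr
          exact hcard n
      _ = ((2 * N + 1) * M) * (2 ^ (n : ℝ) * (2 : ℝ≥0∞) ^ (b * n) * (2 : ℝ≥0∞) ^ (-(n * q))) := by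
          rw [ENNReal.rpow_natCast]; ring
      _ = _ := by
          rw [← ENNReal.rpow_add _ _ (by norm_num) (by norm_num),
            ← ENNReal.rpow_add _ _ (by norm_num) (by norm_num), ← ENNReal.rpow_natCast,
            ← ENNReal.rpow_mul]
          congr 2
          rw [hb]
          ring
  have hS : ∫⁻ x, S x ∂P ≠ ∞ := by
    have h1 : ∫⁻ x, S x ∂P ≤ ∑' n : ℕ, ((2 * N + 1) * M) * ((2 : ℝ≥0∞) ^ (-b)) ^ n := by
      rw [lintegral_tsum fun n =>
        (Finset.measurable_fun_sum _ fun k _ => (hmeas n k).const_mul _).aemeasurable]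
      exact ENNReal.tsum_le_tsum hterm
    refine ne_top_of_le_ne_top ?_ h1
    rw [ENNReal.tsum_mul_left, ENNReal.tsum_geometric]
    refine ENNReal.mul_ne_top (by finiteness) (ENNReal.inv_ne_top.2 ?_)
    have : (2 : ℝ≥0∞) ^ (-b) < 1 := ENNReal.rpow_lt_one_of_one_lt_of_neg (by norm_num) (by linarith)
    exact (tsub_pos_of_lt this).ne'
  have hSm : Measurable S := Measurable.tsum fun n =>
    Finset.measurable_fun_sum _ fun k _ => (hmeas n k).const_mul _
  filter_upwards [ae_lt_top hSm hS] with x hx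
  refine ⟨fun n => (S x).toReal ^ (1 / p) * ((2 : ℝ) ^ (-(b / p))) ^ n,
    (summable_geometric_of_lt_one (by positivity)
      (Real.rpow_lt_one_of_one_lt_of_neg (by norm_num) (by
        have : 0 < b / p := by positivity
        linarith))).mul_left _, fun n k hk => ?_⟩
  have hmem : k ∈ G n := Finset.mem_Icc.2 (abs_le.1 hk)
  have h1 : (2 : ℝ≥0∞) ^ (b * n) * edist (X (k / 2 ^ n) x) (X ((k + 1) / 2 ^ n) x) ^ p ≤ S x :=
    (Finset.single_le_sum (f := fun k : ℤ => (2 : ℝ≥0∞) ^ (b * n) *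
      edist (X (k / 2 ^ n) x) (X ((k + 1) / 2 ^ n) x) ^ p) (fun _ _ => zero_le) hmem).trans
      (ENNReal.le_tsum n)
  have h2 := ENNReal.toReal_mono hx.ne h1
  rw [ENNReal.toReal_mul, ← ENNReal.toReal_rpow, ← ENNReal.toReal_rpow, ← dist_edist] at h2
  norm_num at h2
  set d := dist (X (k / 2 ^ n) x) (X ((k + 1) / 2 ^ n) x)
  have hd : 0 ≤ d := dist_nonneg
  have h3 : d ^ p ≤ (S x).toReal * 2 ^ (-(b * n)) := by
    rw [Real.rpow_neg (by norm_num), ← div_eq_mul_inv, le_div_iff₀ (by positivity)]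
    linarith
  calc d = (d ^ p) ^ (1 / p) := by
        rw [← Real.rpow_mul hd, mul_one_div_cancel hp.ne', Real.rpow_one]
    _ ≤ ((S x).toReal * 2 ^ (-(b * n))) ^ (1 / p) := by gcongr
    _ = _ := by
        rw [Real.mul_rpow (by positivity) (by positivity), ← Real.rpow_mul (by norm_num)]
        beta_reduce
        rw [← Real.rpow_mul_natCast (by norm_num)]
        congr 2
        ring

/-- Kolmogorov's continuity criterion on the line. -/
theorem exists_continuous_modification [CompleteSpace E] [Nonempty E] [MeasurableSpace E]
    [BorelSpace E] {p q : ℝ} {M : NNReal} {X : ℝ → Ω → E}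
    (hX : IsKolmogorovProcess X P p q M) (hq : 1 < q) :
    ∃ η : ℝ → Ω → E, (∀ t, Measurable (η t)) ∧ (∀ t, η t =ᵐ[P] X t) ∧
      ∀ᵐ x ∂P, Continuous fun t => η t x := by
  have hae := ae_all_iff.2 fun N => ae_dyadic_increments_le hX hq N
  set B := toMeasurable P {x | ¬ ∀ N : ℕ, ∃ δ : ℕ → ℝ, Summable δ ∧ ∀ n, ∀ k : ℤ,
    |k| ≤ N * 2 ^ n → dist (X (k / 2 ^ n) x) (X ((k + 1) / 2 ^ n) x) ≤ δ n} with hB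
  have hB0 : P B = 0 := by rw [hB, measure_toMeasurable]; exact hae
  have hBm : MeasurableSet B := measurableSet_toMeasurable _ _
  have hBae : ∀ᵐ x ∂P, x ∉ B := measure_eq_zero_iff_ae_notMem.1 hB0
  have hgood : ∀ x, x ∉ B → ∃ g : ℝ → E, Continuous g ∧
      ∀ t, Tendsto (fun n => X (dyadicFloor n t) x) atTop (𝓝 (g t)) := by
    intro x hx
    exact exists_continuous_of_dyadic_increments (f := fun t => X t x)
      (not_not.1 fun h => hx (subset_toMeasurable P _ h))
  classical
  obtain ⟨e⟩ := ‹Nonempty E›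
  let η : ℝ → Ω → E := fun t x => if hx : x ∈ B then e else (hgood x hx).choose t
  have hη : ∀ x (hx : x ∉ B) t, η t x = (hgood x hx).choose t := fun x hx t => dif_neg hx
  have hlim : ∀ x, x ∉ B → ∀ t, Tendsto (fun n => X (dyadicFloor n t) x) atTop (𝓝 (η t x)) := by
    intro x hx t
    rw [hη x hx]
    exact (hgood x hx).choose_spec.2 t
  refine ⟨η, fun t => ?_, fun t => ?_, ?_⟩
  · refine measurable_of_tendsto_metrizable
      (f := fun n => B.piecewise (fun _ => e) (X (dyadicFloor n t)))
      (fun n => Measurable.piecewise hBm measurable_const (hX.measurable _)) ?_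
    rw [tendsto_pi_nhds]
    intro x
    by_cases hx : x ∈ B
    · simp [η, hx]
    · simp only [Set.piecewise_eq_of_notMem _ _ _ hx]
      exact hlim x hx t
  · -- the dyadic approximations converge to `η t` almost surely and to `X t` in probability
    have h1 : TendstoInMeasure P (fun n => X (dyadicFloor n t)) atTop (X t) := by
      have h0 : Tendsto (fun n => (M : ℝ≥0∞) * edist (dyadicFloor n t) t ^ q) atTop (𝓝 0) := by
        have h2 : Tendsto (fun n => edist (dyadicFloor n t) t) atTop (𝓝 0) :=
          tendsto_iff_edist_tendsto_0.1 (tendsto_dyadicFloor t)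
        have h3 := h2.ennrpow_const q
        rw [ENNReal.zero_rpow_of_pos hX.q_pos] at h3
        simpa using ENNReal.Tendsto.const_mul h3 (Or.inr ENNReal.coe_ne_top)
      intro ε hε
      rcases eq_or_ne ε ∞ with rfl | hε'
      · simp [edist_ne_top]
      have hp := hX.p_pos
      have h4 : Tendsto (fun n => ((M : ℝ≥0∞) * edist (dyadicFloor n t) t ^ q) / ε ^ p) atTop
          (𝓝 0) := by
        have := ENNReal.Tendsto.div_const (b := ε ^ p) h0
          (Or.inr (ENNReal.rpow_pos hε hε').ne')
        simpa using this
      refine tendsto_of_tendsto_of_tendsto_of_le_of_le tendsto_const_nhds h4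
        (fun _ => zero_le) fun n => ?_
      have h5 : {x | ε ≤ edist (X (dyadicFloor n t) x) (X t x)} ⊆
          {x | ε ^ p ≤ edist (X (dyadicFloor n t) x) (X t x) ^ p} := fun x hx =>
        ENNReal.rpow_le_rpow hx hp.le
      refine (measure_mono h5).trans ((meas_ge_le_lintegral_div
        (hX.measurable_edist.pow_const p).aemeasurable (ENNReal.rpow_pos hε hε').ne'
        (ENNReal.rpow_ne_top_of_nonneg hp.le hε')).trans ?_)
      gcongr
      exact hX.kolmogorovCondition _ _
    obtain ⟨ns, hns, hsub⟩ := h1.exists_seq_tendsto_ae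
    filter_upwards [hBae, hsub] with x hx hx2
    exact tendsto_nhds_unique ((hlim x hx t).comp hns.tendsto_atTop) hx2
  · filter_upwards [hBae] with x hx
    simp only [hη x hx]
    exact (hgood x hx).choose_spec.1

end Kolmogorov

end GLE

namespace GLE

/-! ### The stochastic integral is an isometry onto a centred Gaussian space -/

section GaussianSpace

variable {Ω : Type*} [MeasurableSpace Ω] {P : Measure Ω} [IsProbabilityMeasure P]

theorem integral_mul_self_eq_norm_sq {Ω : Type*} [MeasurableSpace Ω] {P : Measure Ω}
    (g : Lp ℝ 2 P) : ∫ x, g x * g x ∂P = ‖g‖ ^ 2 := by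
  rw [← real_inner_self_eq_norm_sq, L2.inner_def]
  simp [sq]

/-- Being centred Gaussian is a closed condition in `L²`: the characteristic function and the
variance are continuous on `L²`. -/
theorem isClosed_setOf_map_eq_gaussianReal :
    IsClosed {g : Lp ℝ 2 P | P.map g = gaussianReal 0 (‖g‖₊ ^ 2)} := by
  have heq : {g : Lp ℝ 2 P | P.map g = gaussianReal 0 (‖g‖₊ ^ 2)} =
      {g : Lp ℝ 2 P | ∀ s : ℝ, ∫ x, Complex.exp (s * g x * Complex.I) ∂P =
        Complex.exp (-(‖g‖ ^ 2 * s ^ 2 / 2 : ℝ))} := by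
    ext g
    have hg : AEMeasurable g P := (Lp.aestronglyMeasurable g).aemeasurable
    have : IsProbabilityMeasure (P.map g) := Measure.isProbabilityMeasure_map hg
    have h1 : ∀ s : ℝ, charFun (P.map g) s = ∫ x, Complex.exp (s * g x * Complex.I) ∂P := by
      intro s
      rw [charFun_apply_real, integral_map hg (by fun_prop)]
    have h2 : ∀ s : ℝ, charFun (gaussianReal 0 (‖g‖₊ ^ 2)) s =
        Complex.exp (-(‖g‖ ^ 2 * s ^ 2 / 2 : ℝ)) := by
      intro s
      rw [charFun_gaussianReal]
      congr 1
      push_cast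
      simp
    constructor
    · intro h s
      have h : P.map g = gaussianReal 0 (‖g‖₊ ^ 2) := h
      rw [← h1, h, h2]
    · intro h
      refine Measure.ext_of_charFun (funext fun s => ?_)
      rw [h1, h s, h2]
  rw [heq]
  have : {g : Lp ℝ 2 P | ∀ s : ℝ, ∫ x, Complex.exp (s * g x * Complex.I) ∂P =
        Complex.exp (-(‖g‖ ^ 2 * s ^ 2 / 2 : ℝ))} = ⋂ s : ℝ, {g : Lp ℝ 2 P |
        ∫ x, Complex.exp (s * g x * Complex.I) ∂P =
          Complex.exp (-(‖g‖ ^ 2 * s ^ 2 / 2 : ℝ))} := by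
    ext g
    simp
  rw [this]
  refine isClosed_iInter fun s => isClosed_eq ?_ (by fun_prop)
  have hint : ∀ g : Lp ℝ 2 P, Integrable (fun x => Complex.exp (s * g x * Complex.I)) P := by
    intro g
    refine Integrable.of_bound (C := 1) ?_ (Eventually.of_forall fun x => ?_)
    · have := Lp.aestronglyMeasurable g
      fun_prop
    · rw [← Complex.ofReal_mul, Complex.norm_exp_ofReal_mul_I]
  refine (LipschitzWith.of_dist_le_mul (K := ‖s‖₊) fun g h => ?_).continuous
  rw [dist_eq_norm, dist_eq_norm, ← integral_sub (hint g) (hint h)]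
  have hL2 : MemLp (fun x => (g - h) x) 2 P := Lp.memLp (g - h)
  have hL1 : ∫ x, ‖(g - h) x‖ ∂P ≤ ‖g - h‖ := by
    have h1 := eLpNorm_le_eLpNorm_of_exponent_le (p := 1) (q := 2) (μ := P) (by norm_num)
      hL2.aestronglyMeasurable
    rw [eLpNorm_one_eq_lintegral_enorm] at h1
    rw [integral_norm_eq_lintegral_enorm hL2.aestronglyMeasurable, Lp.norm_def]
    exact ENNReal.toReal_mono hL2.eLpNorm_ne_top h1
  calc ‖∫ x, Complex.exp (s * g x * Complex.I) - Complex.exp (s * h x * Complex.I) ∂P‖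
      ≤ ∫ x, ‖s‖ * ‖(g - h) x‖ ∂P := by
        refine norm_integral_le_of_norm_le
          ((hL2.integrable (by norm_num)).norm.const_mul _) ?_
        filter_upwards [Lp.coeFn_sub g h] with x hx
        rw [hx]
        have e : Complex.exp (s * g x * Complex.I) - Complex.exp (s * h x * Complex.I) =
            Complex.exp (s * h x * Complex.I) *
              (Complex.exp (Complex.I * (s * (g x - h x) : ℝ)) - 1) := by
          rw [mul_sub, ← Complex.exp_add, mul_one]
          congr 2
          push_cast
          ring
        rw [e, norm_mul, ← Complex.ofReal_mul, Complex.norm_exp_ofReal_mul_I, one_mul]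
        refine (Real.norm_exp_I_mul_ofReal_sub_one_le).trans_eq ?_
        rw [norm_mul]
        rfl
    _ = ‖s‖ * ∫ x, ‖(g - h) x‖ ∂P := integral_const_mul _ _
    _ ≤ _ := by
      gcongr
      simp

/-- The real part as a map `L²(Ω; ℂ) → L²(Ω; ℝ)`. -/
noncomputable def reLp (P : Measure Ω) : Lp ℂ 2 P →L[ℝ] Lp ℝ 2 P :=
  Complex.reCLM.compLpL 2 P

theorem coeFn_reLp {P : Measure Ω} (f : Lp ℂ 2 P) : reLp P f =ᵐ[P] fun x => (f x).re :=
  Complex.reCLM.coeFn_compLp f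

theorem norm_reLp_le {P : Measure Ω} (f : Lp ℂ 2 P) : ‖reLp P f‖ ≤ ‖f‖ := by
  refine Lp.norm_le_norm_of_ae_le ?_
  filter_upwards [coeFn_reLp f] with x hx
  rw [hx]
  exact Complex.abs_re_le_norm _

variable {ν : Measure ℝ}

namespace GaussianRandomMeasure

omit [IsProbabilityMeasure P] in
theorem coeFn_simpleInt (ξ : GaussianRandomMeasure ν P) (a : FiniteBorel ν →₀ ℂ) :
    ξ.simpleInt a =ᵐ[P] fun x => ∑ E ∈ a.support, a E * ξ.toFun E x := by
  rw [simpleInt, Finsupp.linearCombination_apply, Finsupp.sum]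
  have h2 : ∀ᵐ x ∂P, ∀ E ∈ a.support, (a E • ξ.toFun E) x = a E * ξ.toFun E x :=
    (ae_ball_iff a.support.countable_toSet).2 fun E _ => by
      filter_upwards [Lp.coeFn_smul (a E) (ξ.toFun E)] with x hx
      rw [hx]
      rfl
  filter_upwards [Lp.coeFn_finsetSum a.support fun E => a E • ξ.toFun E, h2] with x h1 h2
  rw [h1, Finset.sum_apply]
  exact Finset.sum_congr rfl h2

/-- The real part of a stochastic integral is centred Gaussian: so it is for simple integrands, and
these are dense. -/
theorem map_reLp_integral (ξ : GaussianRandomMeasure ν P) (g : Lp ℂ 2 ν) :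
    P.map (reLp P (ξ.integral g)) = gaussianReal 0 (‖reLp P (ξ.integral g)‖₊ ^ 2) := by
  refine (denseRange_simpleFun ν).induction_on
    (p := fun g => P.map (reLp P (ξ.integral g)) =
      gaussianReal 0 (‖reLp P (ξ.integral g)‖₊ ^ 2)) g
    (isClosed_setOf_map_eq_gaussianReal.preimage
      ((reLp P).continuous.comp ξ.integral.continuous)) fun a => ?_
  rw [integral, LinearMap.extendOfNorm_eq (denseRange_simpleFun ν)
    ⟨1, fun x => by rw [ξ.norm_simpleInt, one_mul]⟩]
  have hre : reLp P (ξ.simpleInt a) =ᵐ[P]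
      fun x => ∑ E ∈ a.support, (a E * ξ.toFun E x).re := by
    filter_upwards [coeFn_reLp (ξ.simpleInt a), ξ.coeFn_simpleInt a] with x h1 h2
    rw [h1, h2, Complex.re_sum]
  have hlaw : HasGaussianLaw (reLp P (ξ.simpleInt a)) P := by
    have h1 := ξ.gaussian.comp_left fun E =>
      Complex.reCLM ∘L (ContinuousLinearMap.mul ℝ ℂ (a E))
    exact (h1.hasGaussianLaw_fun_sum (I := a.support)).congr hre.symm
  have hmean : ∫ x, reLp P (ξ.simpleInt a) x ∂P = 0 := by
    have hint : ∀ E, Integrable (fun x => a E * ξ.toFun E x) P := fun E =>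
      ((Lp.memLp (ξ.toFun E)).integrable (by norm_num)).const_mul _
    rw [integral_congr_ae hre]
    simp only [← RCLike.re_eq_complex_re]
    rw [integral_finsetSum _ fun E _ => (hint E).re]
    refine Finset.sum_eq_zero fun E _ => ?_
    rw [integral_re (hint E), integral_const_mul, ξ.mean_zero]
    simp
  rw [hlaw.map_eq_gaussianReal, hmean]
  congr 1
  rw [variance_of_integral_eq_zero hlaw.aemeasurable hmean]
  have := integral_mul_self_eq_norm_sq (reLp P (ξ.simpleInt a))
  simp only [← sq] at this
  rw [this]
  ext
  simp

omit [IsProbabilityMeasure P] in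
theorem inner_integral (ξ : GaussianRandomMeasure ν P) (f g : Lp ℂ 2 ν) :
    inner ℂ (ξ.integral f) (ξ.integral g) = inner ℂ f g :=
  LinearIsometry.inner_map_map (⟨ξ.integral.toLinearMap, ξ.norm_integral⟩ :
    Lp ℂ 2 ν →ₗᵢ[ℂ] Lp ℂ 2 P) f g

/-- Stochastic integrals are centred. -/
theorem integral_integral_eq_zero (ξ : GaussianRandomMeasure ν P) (g : Lp ℂ 2 ν) :
    ∫ x, ξ.integral g x ∂P = 0 := by
  have hre : ∀ g, ∫ x, (ξ.integral g x).re ∂P = 0 := by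
    intro g
    rw [← integral_congr_ae (coeFn_reLp (ξ.integral g))]
    have h := integral_map (μ := P) (f := fun x : ℝ => x)
      (Lp.aestronglyMeasurable (reLp P (ξ.integral g))).aemeasurable (by fun_prop)
    rw [← h, ξ.map_reLp_integral, integral_id_gaussianReal]
  have hint : ∀ g, Integrable (ξ.integral g) P := fun g =>
    (Lp.memLp (ξ.integral g)).integrable (by norm_num)
  apply Complex.ext
  · rw [← RCLike.re_eq_complex_re, ← integral_re (hint g)]
    simpa using hre g
  · rw [← RCLike.im_eq_complex_im, ← integral_im (hint g)]
    -- the imaginary part of `z` is the real part of `-i z`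
    have h1 := hre ((-Complex.I) • g)
    rw [map_smul] at h1
    rw [map_zero, ← h1]
    refine integral_congr_ae ?_
    filter_upwards [Lp.coeFn_smul (-Complex.I) (ξ.integral g)] with x hx
    rw [hx]
    simp

/-- The stochastic integrals form a Gaussian process indexed by `L²(ν)`: every real linear
functional of finitely many of them is the real part of a single stochastic integral. -/
theorem isGaussianProcess_integral (ξ : GaussianRandomMeasure ν P) :
    IsGaussianProcess (fun (g : Lp ℂ 2 ν) x => ξ.integral g x) P := by
  classical
  refine ⟨fun I => ⟨isGaussian_of_map_eq_gaussianReal fun L => ?_⟩⟩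
  have hmeas : AEMeasurable (fun x => I.restrict (fun g => ξ.integral g x)) P :=
    aemeasurable_pi_lambda _ fun g => (Lp.aestronglyMeasurable _).aemeasurable
  -- every real linear functional of complex variables is `y ↦ Re (∑ cᵢ yᵢ)`
  let c : I → ℂ := fun i =>
    (L (Pi.single i 1) : ℂ) - Complex.I * L (Pi.single i Complex.I)
  have hL : ∀ y : I → ℂ, L y = ∑ i, (c i * y i).re := by
    intro y
    have h1 : y = ∑ i, ((y i).re • (Pi.single i 1 : I → ℂ) +
        (y i).im • (Pi.single i Complex.I : I → ℂ)) := by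
      ext j
      simp only [Finset.sum_apply, Pi.add_apply, Pi.smul_apply, Pi.single_apply, smul_ite,
        smul_zero, Finset.sum_add_distrib, Finset.sum_ite_eq, Finset.mem_univ, if_true]
      simp
    conv_lhs => rw [h1]
    rw [map_sum]
    refine Finset.sum_congr rfl fun i _ => ?_
    rw [map_add, map_smul, map_smul]
    simp [c]
    ring
  refine ⟨0, ‖reLp P (ξ.integral (∑ i : I, c i • (i : Lp ℂ 2 ν)))‖₊ ^ 2, ?_⟩
  rw [AEMeasurable.map_map_of_aemeasurable (by fun_prop) hmeas, ← ξ.map_reLp_integral]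
  refine Measure.map_congr ?_
  have h2 : ∀ᵐ x ∂P, ∀ i : I,
      (c i • ξ.integral (i : Lp ℂ 2 ν)) x = c i * ξ.integral (i : Lp ℂ 2 ν) x :=
    ae_all_iff.2 fun i => by
      filter_upwards [Lp.coeFn_smul (c i) (ξ.integral (i : Lp ℂ 2 ν))] with x hx
      rw [hx]
      rfl
  filter_upwards [coeFn_reLp (ξ.integral (∑ i : I, c i • (i : Lp ℂ 2 ν))), h2,
    Lp.coeFn_finsetSum Finset.univ fun i : I => c i • ξ.integral (i : Lp ℂ 2 ν)] with x h3 h4 h5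
  rw [h3, map_sum]
  simp only [map_smul]
  rw [h5, Finset.sum_apply, Complex.re_sum, Function.comp_apply, hL]
  exact Finset.sum_congr rfl fun i _ => by rw [h4]; rfl

theorem lintegral_enorm_reLp_integral_rpow (ξ : GaussianRandomMeasure ν P) (g : Lp ℂ 2 ν) {p : ℝ}
    (hp : 0 ≤ p) : ∫⁻ x, ‖reLp P (ξ.integral g) x‖ₑ ^ p ∂P ≤
      ‖g‖ₑ ^ p * ∫⁻ y, ‖y‖ₑ ^ p ∂(gaussianReal 0 1) := by
  set h := reLp P (ξ.integral g) with hh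
  have h1 : ∫⁻ x, ‖h x‖ₑ ^ p ∂P = ∫⁻ y, ‖y‖ₑ ^ p ∂(P.map h) :=
    (lintegral_map' (f := fun y : ℝ => ‖y‖ₑ ^ p) (by fun_prop)
      (Lp.aestronglyMeasurable h).aemeasurable).symm
  have h2 : gaussianReal 0 (‖h‖₊ ^ 2) = (gaussianReal 0 1).map (fun y => ‖h‖ * y) := by
    rw [gaussianReal_map_const_mul, mul_zero, mul_one]
    congr 1
  rw [h1, ξ.map_reLp_integral, h2, lintegral_map (by fun_prop) (by fun_prop)]
  have h3 : ∀ y : ℝ, ‖‖h‖ * y‖ₑ ^ p = ‖h‖ₑ ^ p * ‖y‖ₑ ^ p := by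
    intro y
    rw [enorm_mul, enorm_norm, ENNReal.mul_rpow_of_nonneg _ _ hp]
  simp only [h3]
  rw [lintegral_const_mul _ (by fun_prop)]
  gcongr
  rw [enorm_le_iff_norm_le, ← ξ.norm_integral]
  exact norm_reLp_le _

/-- All moments of a stochastic integral are controlled by its second moment. -/
theorem lintegral_enorm_integral_rpow_le (ξ : GaussianRandomMeasure ν P) (g : Lp ℂ 2 ν) {p : ℝ}
    (hp : 1 ≤ p) : ∫⁻ x, ‖ξ.integral g x‖ₑ ^ p ∂P ≤
      2 ^ p * (∫⁻ y, ‖y‖ₑ ^ p ∂(gaussianReal 0 1)) * ‖g‖ₑ ^ p := by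
  have hp0 : 0 ≤ p := by linarith
  have hpt : ∀ᵐ x ∂P, ‖ξ.integral g x‖ₑ ^ p ≤ 2 ^ (p - 1) *
      (‖reLp P (ξ.integral g) x‖ₑ ^ p + ‖reLp P (ξ.integral ((-Complex.I) • g)) x‖ₑ ^ p) := by
    filter_upwards [coeFn_reLp (ξ.integral g), coeFn_reLp (ξ.integral ((-Complex.I) • g)),
      Lp.coeFn_smul (-Complex.I) (ξ.integral g)] with x h1 h2 h3
    have h4 : reLp P (ξ.integral ((-Complex.I) • g)) x = (ξ.integral g x).im := by
      rw [h2, map_smul, h3]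
      simp
    rw [h1, h4]
    refine le_trans ?_ (ENNReal.rpow_add_le_mul_rpow_add_rpow _ _ hp)
    gcongr
    have h5 := Complex.norm_le_abs_re_add_abs_im (ξ.integral g x)
    rw [← ofReal_norm, ← ofReal_norm, ← ofReal_norm, ← ENNReal.ofReal_add (by positivity)
      (by positivity)]
    exact ENNReal.ofReal_le_ofReal h5
  refine (lintegral_mono_ae hpt).trans ?_
  have hm : ∀ f : Lp ℝ 2 P, AEMeasurable (fun x => ‖f x‖ₑ ^ p) P := fun f =>
    (Lp.aestronglyMeasurable f).enorm.pow_const p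
  rw [lintegral_const_mul'' _ (by fun_prop), lintegral_add_left' (hm _)]
  have hI : ‖(-Complex.I) • g‖ₑ = ‖g‖ₑ := by
    rw [enorm_smul, enorm_neg]
    have : ‖Complex.I‖ₑ = 1 := by
      rw [← ofReal_norm]
      simp
    rw [this, one_mul]
  have h6 := ξ.lintegral_enorm_reLp_integral_rpow g hp0
  have h7 := ξ.lintegral_enorm_reLp_integral_rpow ((-Complex.I) • g) hp0
  rw [hI] at h7
  refine (mul_le_mul_right (add_le_add h6 h7) _).trans_eq ?_
  rw [← two_mul, ENNReal.rpow_sub _ _ (by norm_num) (by norm_num), ENNReal.rpow_one,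
    ← mul_assoc, ENNReal.div_mul_cancel (by norm_num) (by norm_num)]
  ring

end GaussianRandomMeasure

theorem lintegral_enorm_rpow_gaussianReal_ne_top {p : ℝ} (hp : 0 < p) :
    ∫⁻ y, ‖y‖ₑ ^ p ∂(gaussianReal 0 1) ≠ ∞ := by
  have h := memLp_id_gaussianReal' (μ := 0) (v := 1) (ENNReal.ofReal p) ENNReal.ofReal_ne_top
  have h2 := lintegral_rpow_enorm_lt_top_of_eLpNorm_lt_top (by simpa using hp)
    ENNReal.ofReal_ne_top h.eLpNorm_lt_top
  rw [ENNReal.toReal_ofReal hp.le] at h2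
  exact h2.ne

end GaussianSpace

end GLE

namespace GLE

/-! ### Oscillatory integrals of the memory kernel -/

/-- The character `x ↦ exp (i x)` of the real line. -/
noncomputable def osc (x : ℝ) : ℂ := Complex.exp (x * Complex.I)

@[simp]
theorem norm_osc (x : ℝ) : ‖osc x‖ = 1 := Complex.norm_exp_ofReal_mul_I x

@[continuity, fun_prop]
theorem continuous_osc : Continuous osc := by
  unfold osc
  fun_prop

@[simp]
theorem osc_zero : osc 0 = 1 := by simp [osc]

theorem osc_add (x y : ℝ) : osc (x + y) = osc x * osc y := by
  rw [osc, osc, osc, ← Complex.exp_add]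
  push_cast
  ring_nf

theorem conj_osc (x : ℝ) : conj (osc x) = osc (-x) := by
  rw [osc, osc, ← Complex.exp_conj]
  simp

theorem norm_osc_sub_one_le (x : ℝ) : ‖osc x - 1‖ ≤ |x| := by
  have h := Real.norm_exp_I_mul_ofReal_sub_one_le (x := x)
  rwa [mul_comm] at h

theorem fourierS_eq_osc (φ : 𝓢(ℝ, ℂ)) (ω : ℝ) :
    fourierS φ ω = ∫ t, φ t * osc (-(t * ω)) := by
  rw [fourierS_apply]
  refine integral_congr_ae (Eventually.of_forall fun t => ?_)
  simp only [osc]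
  push_cast
  ring_nf

/-- Fubini's theorem for the integral of a product against a bounded continuous kernel. -/
theorem integral_mul_integral_kernel_swap {μ ρ : Measure ℝ} [SFinite μ] [SFinite ρ]
    {f g : ℝ → ℂ} (hf : Integrable f ρ) (hg : Integrable g μ) {c : ℝ → ℝ → ℂ}
    (hc : Continuous fun z : ℝ × ℝ => c z.1 z.2) (hb : ∀ t ω, ‖c t ω‖ ≤ 1) :
    ∫ t, g t * ∫ ω, f ω * c t ω ∂ρ ∂μ = ∫ ω, f ω * ∫ t, g t * c t ω ∂μ ∂ρ := by
  have hint : Integrable (Function.uncurry fun t ω => g t * (f ω * c t ω)) (μ.prod ρ) := by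
    have h := (hg.mul_prod hf).mul_bdd (c := 1) hc.aestronglyMeasurable
      (Eventually.of_forall fun z => hb z.1 z.2)
    refine h.congr (Eventually.of_forall fun z => ?_)
    simp only [Function.uncurry]
    ring
  simp only [← integral_const_mul]
  rw [integral_integral_swap hint]
  refine integral_congr_ae (Eventually.of_forall fun ω => ?_)
  refine integral_congr_ae (Eventually.of_forall fun t => ?_)
  simp only
  ring

theorem continuous_integral_mul_osc {f : ℝ → ℂ} (hf : Integrable f) :
    Continuous fun t : ℝ => ∫ ω, f ω * osc (t * ω) := by
  refine continuous_of_dominated (bound := fun ω => ‖f ω‖) (fun t => ?_)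
    (fun t => Eventually.of_forall fun ω => by simp) hf.norm
    (Eventually.of_forall fun ω => by fun_prop)
  exact hf.aestronglyMeasurable.mul (by fun_prop)

theorem norm_integral_mul_osc_le (f : ℝ → ℂ) (t : ℝ) :
    ‖∫ ω, f ω * osc (t * ω)‖ ≤ ∫ ω, ‖f ω‖ := by
  refine (norm_integral_le_integral_norm _).trans_eq ?_
  simp

section Kernel

variable {K : ℝ → ℝ} {A : ℝ}

theorem nonneg_of_antitoneOn_of_tendsto_zero (hA : AntitoneOn K (Ici A))
    (h0 : Tendsto K atTop (𝓝 0)) {t : ℝ} (ht : A ≤ t) : 0 ≤ K t := by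
  refine le_of_tendsto h0 ?_
  filter_upwards [eventually_ge_atTop t] with s hs
  exact hA ht (ht.trans hs) hs

theorem intervalIntegrable_of_locallyIntegrable {E : Type*} [NormedAddCommGroup E]
    {K : ℝ → E} (hK : LocallyIntegrable K) (a b : ℝ) : IntervalIntegrable K volume a b :=
  (hK.integrableOn_isCompact isCompact_uIcc).intervalIntegrable

theorem intervalIntegrable_mul_continuous {E : Type*} [NormedRing E]
    {K g : ℝ → E} (hK : LocallyIntegrable K) (hg : Continuous g) (a b : ℝ) :
    IntervalIntegrable (fun t => K t * g t) volume a b :=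
  (intervalIntegrable_of_locallyIntegrable hK a b).mul_continuousOn hg.continuousOn

/-- Oscillatory integrals of a decreasing function are bounded by its first value times the
wave length. Shifting the variable by half a period `h = π / |ω|` changes the sign of the character,
so that twice the integral is, up to boundary terms, the oscillatory integral of the nonnegative
function `K t - K (t + h)`, whose integral telescopes. -/
theorem norm_integral_mul_osc_le_of_antitoneOn (hA : AntitoneOn K (Ici A))
    (h0 : Tendsto K atTop (𝓝 0)) (hK : LocallyIntegrable K) {a b ω : ℝ} (ha : A ≤ a)
    (hab : a ≤ b) (hω : ω ≠ 0) :
    ‖∫ t in a..b, (K t : ℂ) * osc (t * ω)‖ ≤ 2 * (Real.pi / |ω|) * K a := by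
  set h := Real.pi / |ω| with hh
  have hωp : 0 < |ω| := abs_pos.2 hω
  have hpos : 0 < h := div_pos Real.pi_pos hωp
  have hKC : LocallyIntegrable fun t => (K t : ℂ) := fun x => by
    obtain ⟨s, hs, hi⟩ := hK x
    exact ⟨s, hs, hi.ofReal⟩
  have hsK : LocallyIntegrable fun t => K (t + h) := by
    rw [MeasureTheory.locallyIntegrable_iff] at hK ⊢
    intro k hk
    have h1 := hK _ (hk.image (continuous_add_const h))
    exact ((measurePreserving_add_right volume h).integrableOn_image
      (measurableEmbedding_addRight h)).1 h1
  have hsKC : LocallyIntegrable fun t => (K (t + h) : ℂ) := fun x => by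
    obtain ⟨s, hs, hi⟩ := hsK x
    exact ⟨s, hs, hi.ofReal⟩
  have hosc : Continuous fun t : ℝ => osc (t * ω) := by fun_prop
  have hi1 := intervalIntegrable_mul_continuous hKC hosc
  have hi2 := intervalIntegrable_mul_continuous hsKC hosc
  have hKi : ∀ x y, IntervalIntegrable K volume x y := intervalIntegrable_of_locallyIntegrable hK
  have hflip : ∀ t : ℝ, osc ((t + h) * ω) = - osc (t * ω) := by
    intro t
    have h1 : osc (h * ω) = -1 := by
      rcases lt_or_gt_of_ne hω with h2 | h2
      · have : h * ω = -Real.pi := by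
          rw [hh, abs_of_neg h2]
          field_simp
        rw [this, ← conj_osc, osc, Complex.exp_pi_mul_I]
        simp
      · have : h * ω = Real.pi := by
          rw [hh, abs_of_pos h2]
          field_simp
        rw [this, osc, Complex.exp_pi_mul_I]
    rw [add_mul, osc_add, h1]
    ring
  set J := ∫ t in a..b, (K t : ℂ) * osc (t * ω) with hJ
  have hshift : J = -∫ t in (a - h)..(b - h), (K (t + h) : ℂ) * osc (t * ω) := by
    have := intervalIntegral.integral_comp_add_right
      (fun t => (K t : ℂ) * osc (t * ω)) h (a := a - h) (b := b - h)
    simp only [sub_add_cancel, hflip, mul_neg, intervalIntegral.integral_neg] at this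
    exact this.symm
  have hsplit : (∫ t in (a - h)..(b - h), (K (t + h) : ℂ) * osc (t * ω)) =
      (∫ t in (a - h)..a, (K (t + h) : ℂ) * osc (t * ω)) +
      (∫ t in a..b, (K (t + h) : ℂ) * osc (t * ω)) -
      ∫ t in (b - h)..b, (K (t + h) : ℂ) * osc (t * ω) := by
    rw [intervalIntegral.integral_add_adjacent_intervals (hi2 _ _) (hi2 _ _), eq_sub_iff_add_eq,
      intervalIntegral.integral_add_adjacent_intervals (hi2 _ _) (hi2 _ _)]
  have h2J : J + J = (∫ t in a..b, ((K t - K (t + h) : ℝ) : ℂ) * osc (t * ω)) -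
      (∫ t in (a - h)..a, (K (t + h) : ℂ) * osc (t * ω)) +
      ∫ t in (b - h)..b, (K (t + h) : ℂ) * osc (t * ω) := by
    have : (∫ t in a..b, ((K t - K (t + h) : ℝ) : ℂ) * osc (t * ω)) =
        J - ∫ t in a..b, (K (t + h) : ℂ) * osc (t * ω) := by
      rw [hJ, ← intervalIntegral.integral_sub (hi1 _ _) (hi2 _ _)]
      refine intervalIntegral.integral_congr fun t _ => ?_
      push_cast
      ring
    rw [this]
    nth_rewrite 2 [hshift]
    rw [hsplit]
    ring
  have b1 : ‖∫ t in a..b, ((K t - K (t + h) : ℝ) : ℂ) * osc (t * ω)‖ ≤ h * K a := by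
    calc ‖∫ t in a..b, ((K t - K (t + h) : ℝ) : ℂ) * osc (t * ω)‖
        ≤ ∫ t in a..b, (K t - K (t + h)) := by
          refine intervalIntegral.norm_integral_le_of_norm_le hab
            (Eventually.of_forall fun t ht => ?_)
            ((hKi _ _).sub (intervalIntegrable_of_locallyIntegrable hsK _ _))
          have : K (t + h) ≤ K t := hA (ha.trans ht.1.le)
            ((ha.trans ht.1.le).trans (by linarith)) (by linarith)
          rw [norm_mul, norm_osc, mul_one, Complex.norm_real, Real.norm_of_nonneg (by linarith)]
      _ = (∫ t in a..(a + h), K t) - ∫ t in b..(b + h), K t := by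
          rw [intervalIntegral.integral_sub (hKi _ _)
              (intervalIntegrable_of_locallyIntegrable hsK _ _),
            intervalIntegral.integral_comp_add_right K h,
            sub_eq_sub_iff_add_eq_add,
            intervalIntegral.integral_add_adjacent_intervals (hKi _ _) (hKi _ _),
            intervalIntegral.integral_add_adjacent_intervals (hKi _ _) (hKi _ _)]
      _ ≤ (∫ t in a..(a + h), K a) - 0 := by
          refine sub_le_sub ?_ ?_
          · refine intervalIntegral.integral_mono_on (by linarith) (hKi _ _)
              intervalIntegrable_const fun t ht => ?_
            exact hA ha (ha.trans ht.1) ht.1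
          · refine intervalIntegral.integral_nonneg (by linarith) fun t ht => ?_
            exact nonneg_of_antitoneOn_of_tendsto_zero hA h0 (by linarith [ht.1])
      _ = h * K a := by simp
  have b2 : ∀ c, a ≤ c →
      ‖∫ t in (c - h)..c, (K (t + h) : ℂ) * osc (t * ω)‖ ≤ h * K a := by
    intro c hc
    have := intervalIntegral.norm_integral_le_of_norm_le_const (a := c - h) (b := c)
      (C := K a) (f := fun t => (K (t + h) : ℂ) * osc (t * ω)) fun t ht => ?_
    · refine this.trans_eq ?_
      rw [sub_sub_cancel, abs_of_pos hpos, mul_comm]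
    · rw [uIoc_of_le (by linarith)] at ht
      have h3 : a ≤ t + h := by linarith [ht.1]
      rw [norm_mul, norm_osc, mul_one, Complex.norm_real, Real.norm_of_nonneg
        (nonneg_of_antitoneOn_of_tendsto_zero hA h0 (ha.trans h3))]
      exact hA ha (ha.trans h3) h3
  have hnn := nonneg_of_antitoneOn_of_tendsto_zero hA h0 ha
  have h4 : ‖J + J‖ ≤ h * K a + h * K a + h * K a := by
    rw [h2J]
    refine (norm_add_le _ _).trans (add_le_add ((norm_sub_le _ _).trans
      (add_le_add b1 (b2 a le_rfl))) (b2 b hab))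
  rw [← two_mul, norm_mul] at h4
  norm_num at h4
  nlinarith [mul_nonneg hpos.le hnn]

/-- `k` is, on `1 ≤ |ω|`, the half-line Fourier transform `∫_0^∞ K(s) exp (i s ω) ds` of `K`, as a
boundedly convergent improper integral with bound `M`; its values on `|ω| < 1` are arbitrary. -/
structure IsHalfLineTransform (K : ℝ → ℝ) (k : ℝ → ℂ) (M : ℝ) : Prop where
  measurable : Measurable k
  norm_le : ∀ ω, 1 ≤ |ω| → ‖k ω‖ ≤ M
  tendsto : ∀ ω, 1 ≤ |ω| →
    Tendsto (fun n : ℕ => ∫ s in (0 : ℝ)..n, (K s : ℂ) * osc (s * ω)) atTop (𝓝 (k ω))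
  eventually_norm_le : ∀ᶠ n : ℕ in atTop, ∀ ω, 1 ≤ |ω| →
    ‖∫ s in (0 : ℝ)..n, (K s : ℂ) * osc (s * ω)‖ ≤ M

/-- An eventually decreasing kernel has a half-line Fourier transform away from `ω = 0`. -/
theorem exists_isHalfLineTransform (hA : AntitoneOn K (Ici A)) (h0 : Tendsto K atTop (𝓝 0))
    (hK : LocallyIntegrable K) :
    ∃ (k : ℝ → ℂ) (M : ℝ), IsHalfLineTransform K k M := by
  obtain ⟨N, hN⟩ := exists_nat_ge A
  have hKC : LocallyIntegrable fun t => (K t : ℂ) := fun x => by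
    obtain ⟨s, hs, hi⟩ := hK x
    exact ⟨s, hs, hi.ofReal⟩
  have hi := fun ω : ℝ => intervalIntegrable_mul_continuous hKC
    (g := fun t : ℝ => osc (t * ω)) (by fun_prop)
  set kn : ℕ → ℝ → ℂ := fun n ω => ∫ s in (0 : ℝ)..n, (K s : ℂ) * osc (s * ω) with hkn
  have hNn : ∀ n : ℕ, N ≤ n → A ≤ n := fun n hn => hN.trans (by exact_mod_cast hn)
  have hdiff : ∀ m n : ℕ, N ≤ m → m ≤ n → ∀ ω, 1 ≤ |ω| →
      ‖kn n ω - kn m ω‖ ≤ 2 * Real.pi * K m := by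
    intro m n hm hmn ω hω
    have hωp : 0 < |ω| := by linarith
    have e : kn n ω - kn m ω = ∫ s in (m : ℝ)..n, (K s : ℂ) * osc (s * ω) :=
      intervalIntegral.integral_interval_sub_left (hi ω _ _) (hi ω _ _)
    rw [e]
    refine (norm_integral_mul_osc_le_of_antitoneOn hA h0 hK (hNn m hm)
      (by exact_mod_cast hmn) (abs_pos.1 hωp)).trans ?_
    have := nonneg_of_antitoneOn_of_tendsto_zero hA h0 (hNn m hm)
    gcongr
    exact div_le_self Real.pi_pos.le hω
  set M := (∫ s in (0 : ℝ)..N, |K s|) + 2 * Real.pi * K N with hM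
  have hbound : ∀ n : ℕ, N ≤ n → ∀ ω, 1 ≤ |ω| → ‖kn n ω‖ ≤ M := by
    intro n hn ω hω
    have h1 : ‖kn N ω‖ ≤ ∫ s in (0 : ℝ)..N, |K s| := by
      refine (intervalIntegral.norm_integral_le_integral_norm (by positivity)).trans_eq ?_
      simp
    have h2 := hdiff N n le_rfl hn ω hω
    have h3 := norm_sub_norm_le (kn n ω) (kn N ω)
    rw [hM]
    linarith
  have hlim : ∀ ω, 1 ≤ |ω| → ∃ z, Tendsto (fun n => kn n ω) atTop (𝓝 z) := by
    intro ω hω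
    have hc : CauchySeq fun n => kn (n + N) ω := by
      refine cauchySeq_of_le_tendsto_0' (fun n => 2 * Real.pi * K ((n + N : ℕ) : ℝ))
        (fun m n hmn => ?_) ?_
      · rw [dist_comm, dist_eq_norm]
        exact hdiff _ _ (by omega) (by omega) ω hω
      · have h1 : Tendsto (fun n : ℕ => K ((n + N : ℕ) : ℝ)) atTop (𝓝 0) :=
          h0.comp (tendsto_natCast_atTop_atTop.comp (tendsto_add_atTop_nat N))
        simpa using h1.const_mul (2 * Real.pi)
    obtain ⟨z, hz⟩ := cauchySeq_tendsto_of_complete hc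
    exact ⟨z, (tendsto_add_atTop_iff_nat N).1 hz⟩
  have hcont : ∀ n, Continuous (kn n) := by
    intro n
    refine intervalIntegral.continuous_of_dominated_interval (bound := fun s => |K s|)
      (fun ω => ?_) (fun ω => Eventually.of_forall fun s _ => by simp)
      (intervalIntegrable_of_locallyIntegrable hK _ _).norm
      (Eventually.of_forall fun s _ => by fun_prop)
    exact ((hi ω 0 n).def').aestronglyMeasurable
  choose z hz using hlim
  classical
  have hS : MeasurableSet {ω : ℝ | 1 ≤ |ω|} := measurableSet_le measurable_const (by fun_prop)
  let k : ℝ → ℂ := fun ω => if hω : 1 ≤ |ω| then z ω hω else 0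
  have hk : ∀ ω, 1 ≤ |ω| → Tendsto (fun n => kn n ω) atTop (𝓝 (k ω)) := by
    intro ω hω
    simp only [k, dif_pos hω]
    exact hz ω hω
  refine ⟨k, M, ?_, fun ω hω => ?_, hk, ?_⟩
  · refine measurable_of_tendsto_metrizable (f := fun n => {ω : ℝ | 1 ≤ |ω|}.indicator (kn n))
      (fun n => (hcont n).measurable.indicator hS) ?_
    rw [tendsto_pi_nhds]
    intro ω
    by_cases hω : 1 ≤ |ω|
    · simpa [indicator, hω] using hk ω hω
    · simp [indicator, hω, k]
  · refine le_of_tendsto (hk ω hω).norm ?_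
    filter_upwards [eventually_ge_atTop N] with n hn
    exact hbound n hn ω hω
  · filter_upwards [eventually_ge_atTop N] with n hn
    exact hbound n hn

/-- A locally integrable kernel that eventually decreases to `0`, times a continuous integrable
function, is integrable on the half line. -/
theorem integrableOn_mul_of_antitoneOn (hA : AntitoneOn K (Ici A)) (h0 : Tendsto K atTop (𝓝 0))
    (hK : LocallyIntegrable K) {G : ℝ → ℝ} (hG : Integrable G) (hGc : Continuous G) :
    IntegrableOn (fun s => K s * G s) (Ioi 0) := by
  set B := max A 0 with hB
  have h1 : IntegrableOn (fun s => K s * G s) (Ioc 0 B) :=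
    (intervalIntegrable_iff_integrableOn_Ioc_of_le (le_max_right _ _)).1
      (intervalIntegrable_mul_continuous hK hGc 0 B)
  have h2 : IntegrableOn (fun s => K s * G s) (Ioi B) := by
    refine (hG.integrableOn (s := Ioi B)).bdd_mul (c := K B)
      hK.aestronglyMeasurable.restrict ?_
    refine (ae_restrict_iff' measurableSet_Ioi).2 (Eventually.of_forall fun s hs => ?_)
    have hs : B < s := hs
    have h3 : A ≤ s := (le_max_left A 0).trans hs.le
    rw [Real.norm_of_nonneg (nonneg_of_antitoneOn_of_tendsto_zero hA h0 h3)]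
    exact hA (le_max_left A 0) h3 hs.le
  have := h1.union h2
  rwa [Ioc_union_Ioi_eq_Ioi (le_max_right _ _)] at this

/-- Parseval's identity for the kernel: only frequencies away from `0`, where the half-line
transform is bounded, occur in `w`. -/
theorem integral_mul_integral_osc_eq (hK : LocallyIntegrable K) {k : ℝ → ℂ} {M : ℝ}
    (hk : IsHalfLineTransform K k M)
    {w : ℝ → ℂ} (hw : Integrable w) (hw0 : ∀ ω, |ω| < 1 → w ω = 0)
    (hint : IntegrableOn (fun s => (K s : ℂ) * ∫ ω, w ω * osc (s * ω)) (Ioi 0)) :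
    ∫ s in Ioi 0, (K s : ℂ) * ∫ ω, w ω * osc (s * ω) = ∫ ω, w ω * k ω := by
  have hKC : LocallyIntegrable fun t => (K t : ℂ) := fun x => by
    obtain ⟨s, hs, hi⟩ := hK x
    exact ⟨s, hs, hi.ofReal⟩
  have hl := intervalIntegral_tendsto_integral_Ioi 0 hint tendsto_natCast_atTop_atTop
  have hswap : ∀ n : ℕ, ∫ s in (0 : ℝ)..n, (K s : ℂ) * ∫ ω, w ω * osc (s * ω) =
      ∫ ω, w ω * ∫ s in (0 : ℝ)..n, (K s : ℂ) * osc (s * ω) := by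
    intro n
    simp only [intervalIntegral.integral_of_le (Nat.cast_nonneg n : (0 : ℝ) ≤ n)]
    refine integral_mul_integral_kernel_swap hw ?_ (c := fun s ω => osc (s * ω)) (by fun_prop)
      fun t ω => by simp
    exact (intervalIntegrable_iff_integrableOn_Ioc_of_le (Nat.cast_nonneg n)).1
      (intervalIntegrable_of_locallyIntegrable hKC _ _)
  refine tendsto_nhds_unique (hl.congr hswap) ?_
  refine tendsto_integral_filter_of_dominated_convergence (fun ω => ‖w ω‖ * M) ?_ ?_
    (hw.norm.mul_const M) ?_
  · refine Eventually.of_forall fun n => hw.aestronglyMeasurable.mul ?_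
    refine (intervalIntegral.continuous_of_dominated_interval (bound := fun s => |K s|)
      (fun ω => ?_) (fun ω => Eventually.of_forall fun s _ => by simp)
      (intervalIntegrable_of_locallyIntegrable hK _ _).norm
      (Eventually.of_forall fun s _ => by fun_prop)).aestronglyMeasurable
    exact ((intervalIntegrable_mul_continuous hKC
      (g := fun t : ℝ => osc (t * ω)) (by fun_prop) 0 n).def').aestronglyMeasurable
  · filter_upwards [hk.eventually_norm_le] with n hn
    refine Eventually.of_forall fun ω => ?_
    rcases lt_or_ge |ω| 1 with hω | hω
    · simp [hw0 ω hω]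
    · rw [norm_mul]
      gcongr
      exact hn ω hω
  · refine Eventually.of_forall fun ω => ?_
    rcases lt_or_ge |ω| 1 with hω | hω
    · simp [hw0 ω hω]
    · exact (hk.tendsto ω hω).const_mul _

end Kernel

end GLE

namespace GLE

/-! ### Test functions with prescribed Fourier transform -/

/-- Fourier inversion for the kernel `exp (-i t ω)`. -/
theorem integral_fourierS_mul_osc (χ : 𝓢(ℝ, ℂ)) (ω : ℝ) :
    ∫ t, fourierS χ t * osc (t * ω) = 2 * Real.pi * χ ω := by
  have hpi := Real.pi_pos
  have h1 : ∀ t, fourierS χ t = (𝓕 χ) ((2 * Real.pi)⁻¹ * t) := fun t => rfl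
  have h2 : (𝓕⁻ (𝓕 χ)) ω = χ ω := by rw [FourierTransform.fourierInv_fourier_eq]
  rw [← h2, SchwartzMap.fourierInv_coe, Real.fourierInv_eq']
  have h3 := Measure.integral_comp_mul_left
    (fun y : ℝ => Complex.exp ((2 * Real.pi * (inner ℝ y ω : ℝ) : ℝ) * Complex.I) • (𝓕 χ) y)
    (2 * Real.pi)⁻¹
  rw [inv_inv, abs_of_pos (by positivity)] at h3
  rw [← Complex.ofReal_ofNat, ← Complex.ofReal_mul, ← Complex.real_smul]
  refine Eq.trans ?_ (h3.trans ?_)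
  · refine integral_congr_ae (Eventually.of_forall fun t => ?_)
    simp only [h1, osc, smul_eq_mul]
    rw [mul_comm]
    congr 3
    simp
    field_simp
  · simp

variable {v : ℝ → ℝ}

/-- An even real test function `v` is the Fourier transform of a real Schwartz function, which is
`(2π)⁻¹` times the Fourier transform of `v` itself. -/
theorem exists_schwartz_of_even (hv : ContDiff ℝ ((⊤ : ℕ∞) : WithTop ℕ∞) v)
    (hc : HasCompactSupport v) (he : ∀ ω, v (-ω) = v ω) :
    ∃ φ : 𝓢(ℝ, ℝ), (∀ t, (φ t : ℂ) = (2 * Real.pi : ℂ)⁻¹ * ∫ ω, (v ω : ℂ) * osc (t * ω)) ∧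
      ∀ ω, ∫ t, (φ t : ℂ) * osc (t * ω) = v ω := by
  have hg₁ : HasCompactSupport (Complex.ofRealCLM ∘ v) := hc.comp_left rfl
  have hg₂ : ContDiff ℝ ((⊤ : ℕ∞) : WithTop ℕ∞) (Complex.ofRealCLM ∘ v) :=
    Complex.ofRealCLM.contDiff.comp hv
  let u : 𝓢(ℝ, ℂ) := hg₁.toSchwartzMap hg₂
  have hu : ∀ ω, u ω = (v ω : ℂ) := fun ω => rfl
  have hpi : (Real.pi : ℂ) ≠ 0 := by exact_mod_cast Real.pi_ne_zero
  have h1 : ∀ t, fourierS u t = ∫ ω, (v ω : ℂ) * osc (t * ω) := by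
    intro t
    rw [fourierS_eq_osc, ← integral_neg_eq_self]
    refine integral_congr_ae (Eventually.of_forall fun ω => ?_)
    simp only [hu, he]
    congr 2
    ring
  have hreal : ∀ t, conj (fourierS u t) = fourierS u t := by
    intro t
    rw [h1, ← integral_conj, ← integral_neg_eq_self]
    refine integral_congr_ae (Eventually.of_forall fun ω => ?_)
    simp only [map_mul, Complex.conj_ofReal, conj_osc, he]
    congr 2
    ring
  let φ : 𝓢(ℝ, ℝ) := SchwartzMap.postcompCLM Complex.reCLM
    (((2 * Real.pi)⁻¹ : ℂ) • fourierS u)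
  have hφ : ∀ t, (φ t : ℂ) = (2 * Real.pi : ℂ)⁻¹ * fourierS u t := by
    intro t
    have h2 : φ t = ((2 * Real.pi : ℂ)⁻¹ * fourierS u t).re := rfl
    rw [h2]
    refine Complex.conj_eq_iff_re.1 ?_
    rw [map_mul, hreal, map_inv₀, map_mul, Complex.conj_ofReal, Complex.conj_ofNat]
  refine ⟨φ, fun t => ?_, fun ω => ?_⟩
  · rw [hφ, h1]
  · simp only [hφ, mul_assoc]
    rw [integral_const_mul, integral_fourierS_mul_osc, hu]
    field_simp

/-- The Fourier transform of the distribution given by an inverse Fourier integral. -/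
theorem represents_fourierD_funDist {Q T : ℝ → ℂ} (hQ : Integrable Q)
    (hT : ∀ t, T t = (2 * Real.pi : ℂ)⁻¹ * ∫ ω, Q ω * osc (t * ω)) :
    Represents (fourierD (funDist T)) Q := by
  have hpi : (Real.pi : ℂ) ≠ 0 := by exact_mod_cast Real.pi_ne_zero
  have hTc : Continuous T := by
    rw [funext hT]
    exact (continuous_integral_mul_osc hQ).const_mul _
  have hTb : MemLp T ∞ volume := by
    refine memLp_top_of_bound hTc.aestronglyMeasurable
      (‖(2 * Real.pi : ℂ)⁻¹‖ * ∫ ω, ‖Q ω‖) (Eventually.of_forall fun t => ?_)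
    rw [hT, norm_mul]
    exact mul_le_mul_of_nonneg_left (norm_integral_mul_osc_le Q t) (norm_nonneg _)
  have hrep := represents_funDist_of_memLp_top hTb
  intro χ
  refine ⟨?_, ?_⟩
  · obtain ⟨C, hC⟩ := (SchwartzMap.toBoundedContinuousFunction χ).bddAbove_range_norm_comp
    exact hQ.mul_bdd (c := C) χ.continuous.aestronglyMeasurable
      (Eventually.of_forall fun ω => hC ⟨ω, rfl⟩)
  · rw [fourierD_apply, (hrep (fourierS χ)).2]
    calc ∫ t, T t * fourierS χ t
        = (2 * Real.pi : ℂ)⁻¹ * ∫ t, fourierS χ t * ∫ ω, Q ω * osc (t * ω) := by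
          rw [← integral_const_mul]
          refine integral_congr_ae (Eventually.of_forall fun t => ?_)
          simp only [hT]
          ring
      _ = (2 * Real.pi : ℂ)⁻¹ * ∫ ω, Q ω * (2 * Real.pi * χ ω) := by
          rw [integral_mul_integral_kernel_swap hQ (fourierS χ).integrable
            (c := fun t ω => osc (t * ω)) (by fun_prop) fun t ω => by simp]
          simp only [integral_fourierS_mul_osc]
      _ = ∫ ω, Q ω * χ ω := by
          rw [← integral_const_mul]
          refine integral_congr_ae (Eventually.of_forall fun ω => ?_)
          simp only
          field_simp

section TestOperator

variable {K : ℝ → ℝ} {A : ℝ} {φ : 𝓢(ℝ, ℝ)}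

theorem integrable_ofReal_of_hasCompactSupport (hv : Continuous v) (hc : HasCompactSupport v) :
    Integrable fun ω => (v ω : ℂ) :=
  (hv.integrable_of_hasCompactSupport hc).ofReal

theorem deriv_eq_integral (hv : Continuous v) (hc : HasCompactSupport v)
    (hφ : ∀ t, (φ t : ℂ) = (2 * Real.pi : ℂ)⁻¹ * ∫ ω, (v ω : ℂ) * osc (t * ω)) (t : ℝ) :
    ((deriv φ t : ℝ) : ℂ) = (2 * Real.pi : ℂ)⁻¹ * ∫ ω, (Complex.I * ω * v ω) * osc (t * ω) := by
  have hd : HasDerivAt (fun t : ℝ => ∫ ω, (v ω : ℂ) * osc (t * ω))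
      (∫ ω, (Complex.I * ω * v ω) * osc (t * ω)) t := by
    refine (hasDerivAt_integral_of_dominated_loc_of_deriv_le (s := univ)
      (F := fun t ω => (v ω : ℂ) * osc (t * ω))
      (F' := fun t ω => (Complex.I * ω * v ω) * osc (t * ω))
      (bound := fun ω => ‖(ω : ℝ) * v ω‖) univ_mem ?_ ?_ ?_ ?_ ?_ ?_).2
    · exact Eventually.of_forall fun t => Continuous.aestronglyMeasurable (by fun_prop)
    · exact (integrable_ofReal_of_hasCompactSupport hv hc).mul_bdd (c := 1)
        (Continuous.aestronglyMeasurable (by fun_prop)) (Eventually.of_forall fun ω => by simp)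
    · exact Continuous.aestronglyMeasurable (by fun_prop)
    · exact Eventually.of_forall fun ω t _ => by simp
    · exact ((continuous_id.mul hv).integrable_of_hasCompactSupport hc.mul_left).norm
    · refine Eventually.of_forall fun ω t _ => ?_
      have h1 : HasDerivAt (fun x : ℝ => ((x * ω : ℝ) : ℂ) * Complex.I) (ω * Complex.I) t := by
        have := ((hasDerivAt_id t).mul_const ω).ofReal_comp.mul_const Complex.I
        simpa using this
      have h2 := (h1.cexp).const_mul (v ω : ℂ)
      refine h2.congr_deriv ?_
      simp only [osc]
      ring
  have h1 : HasDerivAt (fun t : ℝ => (φ t : ℂ)) ((deriv φ t : ℝ) : ℂ) t :=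
    (φ.differentiableAt).hasDerivAt.ofReal_comp
  have h2 := hd.const_mul (2 * Real.pi : ℂ)⁻¹
  rw [← funext hφ] at h2
  exact h1.unique h2

theorem integral_plus_mul (G : ℝ → ℝ) : ∫ s, plus K s * G s = ∫ s in Ioi 0, K s * G s := by
  have : (fun s => plus K s * G s) = (Ici (0 : ℝ)).indicator fun s => K s * G s := by
    ext s
    by_cases hs : s ∈ Ici (0 : ℝ) <;> simp [plus, hs]
  rw [this, integral_indicator measurableSet_Ici, integral_Ici_eq_integral_Ioi]

/-- The memory term acts on `φ` as multiplication of the Fourier transform by the half-line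
transform of the kernel. -/
theorem refl_conv_plus_eq (hA : AntitoneOn K (Ici A)) (h0 : Tendsto K atTop (𝓝 0))
    (hK : LocallyIntegrable K) {k : ℝ → ℂ} {M : ℝ} (hk : IsHalfLineTransform K k M)
    (hv : Continuous v) (hc : HasCompactSupport v) (hv0 : ∀ ω, |ω| < 1 → v ω = 0)
    (hφ : ∀ t, (φ t : ℂ) = (2 * Real.pi : ℂ)⁻¹ * ∫ ω, (v ω : ℂ) * osc (t * ω)) (t : ℝ) :
    (refl (conv (plus K) (refl φ)) t : ℂ) =
      (2 * Real.pi : ℂ)⁻¹ * ∫ ω, (k ω * v ω) * osc (t * ω) := by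
  have hpi : (Real.pi : ℂ) ≠ 0 := by exact_mod_cast Real.pi_ne_zero
  have h1 : refl (conv (plus K) (refl φ)) t = ∫ s in Ioi 0, K s * φ (t + s) := by
    rw [← integral_plus_mul]
    simp only [refl, conv]
    refine integral_congr_ae (Eventually.of_forall fun s => ?_)
    simp only
    congr 2
    ring
  have hw : Integrable fun ω => (v ω : ℂ) * osc (t * ω) :=
    (integrable_ofReal_of_hasCompactSupport hv hc).mul_bdd (c := 1)
      (Continuous.aestronglyMeasurable (by fun_prop)) (Eventually.of_forall fun ω => by simp)
  have hG : ∀ s, ∫ ω, ((v ω : ℂ) * osc (t * ω)) * osc (s * ω) = 2 * Real.pi * φ (t + s) := by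
    intro s
    rw [hφ, mul_inv_cancel_left₀ (by simp)]
    refine integral_congr_ae (Eventually.of_forall fun ω => ?_)
    simp only [add_mul, osc_add]
    ring
  have hφi : Integrable fun s => φ (t + s) := (φ.integrable (μ := volume)).comp_add_left t
  have hint : IntegrableOn (fun s => ((K s * φ (t + s) : ℝ) : ℂ)) (Ioi 0) :=
    (integrableOn_mul_of_antitoneOn hA h0 hK hφi (by fun_prop)).ofReal
  have h2 := integral_mul_integral_osc_eq hK hk hw (fun ω hω => by simp [hv0 ω hω]) (by
    simp only [hG]
    refine (hint.const_mul (2 * Real.pi : ℂ)).congr (Eventually.of_forall fun s => ?_)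
    simp only
    push_cast
    ring)
  rw [h1, ← integral_complex_ofReal]
  have h3 : ∫ ω, (k ω * v ω) * osc (t * ω) = ∫ ω, ((v ω : ℂ) * osc (t * ω)) * k ω :=
    integral_congr_ae (Eventually.of_forall fun ω => by simp only; ring)
  rw [h3, ← h2, ← integral_const_mul]
  refine integral_congr_ae (Eventually.of_forall fun s => ?_)
  simp only [hG]
  push_cast
  field_simp

/-- The symbol `-i m ω + λ + β k(ω)` of the operator that the velocity is tested against. -/
noncomputable def symbol (m lam β : ℝ) (k : ℝ → ℂ) (ω : ℝ) : ℂ :=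
  -(m * (Complex.I * ω)) + lam + β * k ω

theorem integrable_symbol_mul {k : ℝ → ℂ} {M : ℝ} (hk : IsHalfLineTransform K k M)
    (hv : Continuous v) (hc : HasCompactSupport v) (hv0 : ∀ ω, |ω| < 1 → v ω = 0) :
    Integrable fun ω => k ω * v ω := by
  have hvi := integrable_ofReal_of_hasCompactSupport hv hc
  refine (hvi.norm.const_mul M).mono' (hk.measurable.aestronglyMeasurable.mul
    hvi.aestronglyMeasurable) (Eventually.of_forall fun ω => ?_)
  rcases lt_or_ge |ω| 1 with hω | hω
  · simp [hv0 ω hω]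
  · rw [norm_mul]
    gcongr
    exact hk.norm_le ω hω

/-- In Fourier space the test operator is multiplication by its symbol. -/
theorem represents_testOp (hA : AntitoneOn K (Ici A)) (h0 : Tendsto K atTop (𝓝 0))
    (hK : LocallyIntegrable K) {k : ℝ → ℂ} {M : ℝ} (hk : IsHalfLineTransform K k M)
    (hv : Continuous v) (hc : HasCompactSupport v) (hv0 : ∀ ω, |ω| < 1 → v ω = 0)
    (hφ : ∀ t, (φ t : ℂ) = (2 * Real.pi : ℂ)⁻¹ * ∫ ω, (v ω : ℂ) * osc (t * ω)) (m lam β : ℝ) :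
    Represents (fourierD (funDist fun t => (testOp m lam β K φ t : ℂ)))
      fun ω => symbol m lam β k ω * v ω := by
  have hvi := integrable_ofReal_of_hasCompactSupport hv hc
  have hdi : Integrable fun ω : ℝ => Complex.I * ω * v ω := by
    have : Integrable fun ω : ℝ => ((ω * v ω : ℝ) : ℂ) :=
      ((continuous_id.mul hv).integrable_of_hasCompactSupport hc.mul_left).ofReal
    refine (this.const_mul Complex.I).congr (Eventually.of_forall fun ω => ?_)
    simp
    ring
  have hki := integrable_symbol_mul hk hv hc hv0
  have hosc : ∀ {w : ℝ → ℂ} (_ : Integrable w) (t : ℝ), Integrable fun ω => w ω * osc (t * ω) :=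
    fun hw t => hw.mul_bdd (c := 1)
      (Continuous.aestronglyMeasurable (by fun_prop)) (Eventually.of_forall fun ω => by simp)
  have hsplit : (fun ω => symbol m lam β k ω * v ω) = fun ω : ℝ =>
      (-m : ℂ) * (Complex.I * ω * v ω) + lam * v ω + β * (k ω * v ω) := by
    ext ω
    simp only [symbol]
    ring
  refine represents_fourierD_funDist ?_ fun t => ?_
  · rw [hsplit]
    exact ((hdi.const_mul _).add (hvi.const_mul _)).add (hki.const_mul _)
  · simp only [testOp]
    push_cast
    rw [deriv_eq_integral hv hc hφ, hφ, refl_conv_plus_eq hA h0 hK hk hv hc hv0 hφ]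
    have e : ∀ ω : ℝ, symbol m lam β k ω * v ω * osc (t * ω) =
        (-m : ℂ) * ((Complex.I * ω * v ω) * osc (t * ω)) + lam * (v ω * osc (t * ω)) +
          β * ((k ω * v ω) * osc (t * ω)) := by
      intro ω
      simp only [symbol]
      ring
    simp only [e]
    have i1 : Integrable fun ω : ℝ => (-m : ℂ) * ((Complex.I * ω * v ω) * osc (t * ω)) +
        lam * (v ω * osc (t * ω)) := ((hosc hdi t).const_mul _).add ((hosc hvi t).const_mul _)
    rw [integral_add i1 ((hosc hki t).const_mul _),
      integral_add ((hosc hdi t).const_mul _) ((hosc hvi t).const_mul _),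
      integral_const_mul, integral_const_mul, integral_const_mul]
    ring

/-- The autocorrelation of `φ` is the inverse Fourier transform of `v²`. -/
theorem conv_refl_eq (hv : Continuous v) (hc : HasCompactSupport v) (he : ∀ ω, v (-ω) = v ω)
    (hφ : ∀ t, (φ t : ℂ) = (2 * Real.pi : ℂ)⁻¹ * ∫ ω, (v ω : ℂ) * osc (t * ω))
    (hφ' : ∀ ω, ∫ t, (φ t : ℂ) * osc (t * ω) = v ω) (t : ℝ) :
    (conv φ (refl φ) t : ℂ) = (2 * Real.pi : ℂ)⁻¹ * ∫ ω, ((v ω ^ 2 : ℝ) : ℂ) * osc (t * ω) := by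
  have hvi := integrable_ofReal_of_hasCompactSupport hv hc
  simp only [conv, refl]
  rw [← integral_complex_ofReal]
  have hw : Integrable fun ω => (v ω : ℂ) * osc (-t * ω) := hvi.mul_bdd (c := 1)
      (Continuous.aestronglyMeasurable (by fun_prop)) (Eventually.of_forall fun ω => by simp)
  have h1 : ∀ s, (φ (-(t - s)) : ℂ) =
      (2 * Real.pi : ℂ)⁻¹ * ∫ ω, ((v ω : ℂ) * osc (-t * ω)) * osc (s * ω) := by
    intro s
    rw [hφ]
    congr 1
    refine integral_congr_ae (Eventually.of_forall fun ω => ?_)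
    simp only [mul_assoc, ← osc_add]
    ring_nf
  have hφi : Integrable fun s => (φ s : ℂ) := (φ.integrable (μ := volume)).ofReal
  calc ∫ s, ((φ s * φ (-(t - s)) : ℝ) : ℂ)
      = (2 * Real.pi : ℂ)⁻¹ * ∫ s, (φ s : ℂ) * ∫ ω, ((v ω : ℂ) * osc (-t * ω)) * osc (s * ω) := by
        rw [← integral_const_mul]
        refine integral_congr_ae (Eventually.of_forall fun s => ?_)
        simp only [Complex.ofReal_mul, h1]
        ring
    _ = (2 * Real.pi : ℂ)⁻¹ * ∫ ω, ((v ω : ℂ) * osc (-t * ω)) * v ω := by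
        rw [integral_mul_integral_kernel_swap hw hφi (c := fun s ω => osc (s * ω)) (by fun_prop)
          fun t ω => by simp]
        simp only [hφ']
    _ = _ := by
        rw [← integral_neg_eq_self]
        congr 1
        refine integral_congr_ae (Eventually.of_forall fun ω => ?_)
        simp only [he]
        push_cast
        ring_nf

theorem integral_mul_self_eq (hv : Continuous v) (hc : HasCompactSupport v)
    (he : ∀ ω, v (-ω) = v ω)
    (hφ : ∀ t, (φ t : ℂ) = (2 * Real.pi : ℂ)⁻¹ * ∫ ω, (v ω : ℂ) * osc (t * ω))
    (hφ' : ∀ ω, ∫ t, (φ t : ℂ) * osc (t * ω) = v ω) :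
    ∫ t, φ t * φ t = (2 * Real.pi)⁻¹ * ∫ ω, v ω ^ 2 := by
  have h1 := conv_refl_eq hv hc he hφ hφ' 0
  have h2 : conv φ (refl φ) 0 = ∫ t, φ t * φ t := by simp [conv, refl]
  rw [h2] at h1
  simp only [zero_mul, osc_zero, mul_one] at h1
  rw [integral_complex_ofReal] at h1
  exact_mod_cast h1

/-- The variance of the coloured noise at `φ` is at most a constant times `∫ v²`, because `v`
vanishes at low frequencies. -/
theorem integral_kernel_mul_conv_le (hA : AntitoneOn K (Ici A)) (h0 : Tendsto K atTop (𝓝 0))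
    (hK : LocallyIntegrable K) (hsymm : ∀ t, t ≠ 0 → K (-t) = K t) {k : ℝ → ℂ} {M : ℝ}
    (hk : IsHalfLineTransform K k M) (hv : ContDiff ℝ ((⊤ : ℕ∞) : WithTop ℕ∞) v)
    (hc : HasCompactSupport v) (he : ∀ ω, v (-ω) = v ω) (hv0 : ∀ ω, |ω| < 1 → v ω = 0)
    (hφ : ∀ t, (φ t : ℂ) = (2 * Real.pi : ℂ)⁻¹ * ∫ ω, (v ω : ℂ) * osc (t * ω))
    (hφ' : ∀ ω, ∫ t, (φ t : ℂ) * osc (t * ω) = v ω) :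
    ∫ t, K t * conv φ (refl φ) t ≤ Real.pi⁻¹ * M * ∫ ω, v ω ^ 2 := by
  have hpi := Real.pi_pos
  have hpi' : (Real.pi : ℂ) ≠ 0 := by exact_mod_cast Real.pi_ne_zero
  have hsc : HasCompactSupport fun ω => v ω ^ 2 := by
    simp only [sq]
    exact hc.mul_left
  obtain ⟨ψ, hψ, -⟩ := exists_schwartz_of_even (v := fun ω => v ω ^ 2) (hv.pow 2) hsc
    (fun ω => by simp [he])
  have hconv : conv φ (refl φ) = ψ := by
    ext t
    have h1 := conv_refl_eq hv.continuous hc he hφ hφ' t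
    rw [← hψ] at h1
    exact_mod_cast h1
  have hψe : ∀ t, ψ (-t) = ψ t := by
    intro t
    have h1 : (ψ (-t) : ℂ) = ψ t := by
      rw [hψ, hψ, ← integral_neg_eq_self]
      congr 1
      refine integral_congr_ae (Eventually.of_forall fun ω => ?_)
      simp [he]
    exact_mod_cast h1
  have habs : ∀ t, K t * ψ t = K |t| * ψ |t| := by
    intro t
    rcases le_or_gt 0 t with ht | ht
    · rw [abs_of_nonneg ht]
    · rw [abs_of_neg ht, hsymm t ht.ne, hψe]
  rw [hconv]
  rw [integral_congr_ae (Eventually.of_forall habs), integral_comp_abs (f := fun t => K t * ψ t)]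
  have hvi : Integrable fun ω => ((v ω ^ 2 : ℝ) : ℂ) :=
    integrable_ofReal_of_hasCompactSupport (hv.continuous.pow 2) hsc
  have hG : ∀ s, ∫ ω, ((v ω ^ 2 : ℝ) : ℂ) * osc (s * ω) = 2 * Real.pi * ψ s := by
    intro s
    rw [hψ, mul_inv_cancel_left₀ (by simp)]
  have hint : IntegrableOn (fun s => ((K s * ψ s : ℝ) : ℂ)) (Ioi 0) :=
    (integrableOn_mul_of_antitoneOn hA h0 hK (ψ.integrable (μ := volume)) ψ.continuous).ofReal
  have h2 := integral_mul_integral_osc_eq hK hk hvi (fun ω hω => by simp [hv0 ω hω]) (by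
    simp only [hG]
    refine (hint.const_mul (2 * Real.pi : ℂ)).congr (Eventually.of_forall fun s => ?_)
    simp only
    push_cast
    ring)
  have h3 : ((2 * Real.pi * ∫ s in Ioi 0, K s * ψ s : ℝ) : ℂ) =
      ∫ ω, ((v ω ^ 2 : ℝ) : ℂ) * k ω := by
    rw [← h2, ← integral_const_mul, ← integral_complex_ofReal]
    refine integral_congr_ae (Eventually.of_forall fun s => ?_)
    simp only [hG]
    push_cast
    ring
  have h4 : ‖∫ ω, ((v ω ^ 2 : ℝ) : ℂ) * k ω‖ ≤ ∫ ω, M * v ω ^ 2 := by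
    refine norm_integral_le_of_norm_le
      (((hv.continuous.pow 2).integrable_of_hasCompactSupport hsc).const_mul M)
      (Eventually.of_forall fun ω => ?_)
    rcases lt_or_ge |ω| 1 with hω | hω
    · simp [hv0 ω hω]
    · rw [norm_mul, Complex.norm_real, Real.norm_of_nonneg (sq_nonneg _), mul_comm]
      gcongr
      exact hk.norm_le ω hω
  rw [← h3, Complex.norm_real, integral_const_mul] at h4
  have h5 := (le_abs_self _).trans h4
  have e : 2 * ∫ s in Ioi 0, K s * ψ s =
      Real.pi⁻¹ * (2 * Real.pi * ∫ s in Ioi 0, K s * ψ s) := by field_simp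
  rw [e, mul_assoc Real.pi⁻¹ M]
  exact mul_le_mul_of_nonneg_left h5 (by positivity)

end TestOperator

end GLE

namespace GLE

/-! ### The spectral measure at high frequencies -/

theorem integral_mul_conj_self {α : Type*} [MeasurableSpace α] {μ : Measure α} (f : Lp ℂ 2 μ) :
    ∫ x, f x * conj (f x) ∂μ = ((‖f‖ ^ 2 : ℝ) : ℂ) := by
  have h := inner_self_eq_norm_sq_to_K (𝕜 := ℂ) f
  rw [L2.inner_def] at h
  rw [Complex.ofReal_pow]
  exact h

theorem norm_toLp_sq {α : Type*} [MeasurableSpace α] {μ : Measure α} {f : α → ℂ}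
    (hf : MemLp f 2 μ) : ‖hf.toLp f‖ ^ 2 = ∫ x, ‖f x‖ ^ 2 ∂μ := by
  have h : ((‖hf.toLp f‖ ^ 2 : ℝ) : ℂ) = ((∫ x, ‖f x‖ ^ 2 ∂μ : ℝ) : ℂ) := by
    rw [← integral_mul_conj_self, ← integral_complex_ofReal]
    refine integral_congr_ae ?_
    filter_upwards [hf.coeFn_toLp] with x hx
    rw [hx, Complex.mul_conj, Complex.normSq_eq_norm_sq]
  exact_mod_cast h

namespace ExtendedDistribution

variable {Ω : Type*} [MeasurableSpace Ω] {P : Measure Ω}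

/-- The integral of `(1 + x²)^(-k)` bounds the measure of every bounded set. -/
theorem isLocallyFiniteMeasure (V : ExtendedDistribution P) : IsLocallyFiniteMeasure V.ν := by
  refine ⟨fun x => ⟨Metric.ball 0 (|x| + 1), ?_, ?_⟩⟩
  · exact Metric.isOpen_ball.mem_nhds (by simp)
  · obtain ⟨k, hk⟩ := V.growth
    refine lt_of_le_of_lt (measure_mono fun y hy => ?_)
      (hk.measure_ge_lt_top (ε := ((1 + (|x| + 1) ^ 2) ^ k)⁻¹) (by positivity))
    have hy : |y| < |x| + 1 := by simpa using hy
    have h2 : y ^ 2 ≤ (|x| + 1) ^ 2 := by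
      rw [← sq_abs y]
      gcongr
    show ((1 + (|x| + 1) ^ 2) ^ k)⁻¹ ≤ ((1 + y ^ 2) ^ k)⁻¹
    gcongr

theorem norm_pair_sq (V : ExtendedDistribution P) {g : 𝓢'(ℝ, ℂ)} {f : ℝ → ℂ}
    (hf : Represents (fourierD g) f) (hf2 : MemLp f 2 V.ν) :
    ‖V.pair g‖ ^ 2 = ∫ ω, ‖f ω‖ ^ 2 ∂V.ν := by
  rw [V.pair_eq hf hf2, V.ξ.norm_integral, norm_toLp_sq]
  simp

end ExtendedDistribution

section Spectral

variable {Ω Ω' : Type*} [MeasurableSpace Ω] [MeasurableSpace Ω'] {P : Measure Ω} {P' : Measure Ω'}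
  {m lam β : ℝ} {K : ℝ → ℝ} {W F : 𝓢(ℝ, ℝ) →ₗ[ℝ] Lp ℝ 2 P'} {V : ExtendedDistribution P}

/-- Whatever the correlation of the two noises, the variance of their sum is at most twice the sum
of their variances. -/
theorem integral_noise_mul_self_le (hlam : 0 ≤ lam) (hβ : 0 < β) (w f : Lp ℝ 2 P') :
    ∫ x, (√(2 * lam) * w x + √β * f x) * (√(2 * lam) * w x + √β * f x) ∂P' ≤
      4 * lam * (∫ x, w x * w x ∂P') + 2 * β * ∫ x, f x * f x ∂P' := by
  have hw : Integrable (fun x => w x * w x) P' := (Lp.memLp w).integrable_mul (Lp.memLp w)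
  have hf : Integrable (fun x => f x * f x) P' := (Lp.memLp f).integrable_mul (Lp.memLp f)
  rw [← integral_const_mul, ← integral_const_mul,
    ← integral_add (hw.const_mul _) (hf.const_mul _)]
  refine integral_mono_of_nonneg (Eventually.of_forall fun x => mul_self_nonneg _)
    ((hw.const_mul _).add (hf.const_mul _)) (Eventually.of_forall fun x => ?_)
  have h1 : √(2 * lam) * √(2 * lam) = 2 * lam := Real.mul_self_sqrt (by linarith)
  have h2 : √β * √β = β := Real.mul_self_sqrt hβ.le
  have h3 := mul_self_nonneg (√(2 * lam) * w x - √β * f x)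
  simp only
  have e1 : 4 * lam * (w x * w x) = 2 * ((√(2 * lam) * w x) * (√(2 * lam) * w x)) := by
    linear_combination (-2 * w x * w x) * h1
  have e2 : 2 * β * (f x * f x) = 2 * ((√β * f x) * (√β * f x)) := by
    linear_combination (-2 * f x * f x) * h2
  rw [e1, e2]
  linarith

theorem memLp_symbol_mul {k : ℝ → ℂ} {M : ℝ} (hk : IsHalfLineTransform K k M) {v : ℝ → ℝ}
    (hv : Continuous v) (hc : HasCompactSupport v) (hv0 : ∀ ω, |ω| < 1 → v ω = 0)
    (ν : Measure ℝ) [IsLocallyFiniteMeasure ν] :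
    MemLp (fun ω => symbol m lam β k ω * v ω) 2 ν := by
  have hb : MemLp (fun ω => (|m| * |ω| + |lam| + |β| * M) * |v ω|) 2 ν :=
    Continuous.memLp_of_hasCompactSupport (by fun_prop) (hc.norm.mul_left)
  refine hb.mono' (Measurable.aestronglyMeasurable ?_) (Eventually.of_forall fun ω => ?_)
  · have := hk.measurable
    unfold symbol
    fun_prop
  · rcases lt_or_ge |ω| 1 with hω | hω
    · simp [hv0 ω hω]
    · rw [norm_mul, Complex.norm_real, Real.norm_eq_abs]
      gcongr
      refine (norm_add₃_le).trans ?_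
      simp only [norm_neg, norm_mul, Complex.norm_real, Complex.norm_I, Real.norm_eq_abs, one_mul]
      gcongr
      exact hk.norm_le ω hω

/-- The energy estimate. Testing the equation against functions whose Fourier transform `v` is
supported at high frequencies, where the inertial term `m i ω` dominates the symbol and the noises
have bounded spectral density, shows that `ω² ν(dω)` is dominated by Lebesgue measure there. -/
theorem exists_integral_sq_mul_le (hm : 0 < m) (hlam : 0 ≤ lam) (hβ : 0 < β)
    (hK : IsAdmissibleKernel K) (hW : IsWhiteNoise W) (hF : HasCovarianceKernel K F)
    (hV : IsWeakSolution m lam β K W F V) :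
    ∃ C A : ℝ, 0 ≤ C ∧ 1 ≤ A ∧ ∀ v : ℝ → ℝ, ContDiff ℝ ((⊤ : ℕ∞) : WithTop ℕ∞) v →
      HasCompactSupport v → (∀ ω, v (-ω) = v ω) → (∀ ω, |ω| < A → v ω = 0) →
      ∫ ω, ω ^ 2 * v ω ^ 2 ∂V.ν ≤ C * ∫ ω, v ω ^ 2 := by
  obtain ⟨B, hB⟩ := hK.eventually_decreasing
  obtain ⟨k, M, hk⟩ := exists_isHalfLineTransform hB hK.tendsto_zero hK.locallyIntegrable
  have hM : 0 ≤ M := (norm_nonneg _).trans (hk.norm_le 1 (by simp))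
  have := V.isLocallyFiniteMeasure
  have hpi := Real.pi_pos
  set D := 4 * lam * (2 * Real.pi)⁻¹ + 2 * β * (Real.pi⁻¹ * M) with hD
  have hD0 : 0 ≤ D := by positivity
  -- beyond this frequency the inertial term is at least twice the rest of the symbol, so that the
  -- symbol is at least `m |ω| / 2` in norm
  refine ⟨(m / 2)⁻¹ ^ 2 * D, max 1 (2 * (lam + β * M) / m), by positivity, le_max_left _ _,
    fun v hv hc he hvA => ?_⟩
  have hv0 : ∀ ω, |ω| < 1 → v ω = 0 := fun ω hω => hvA ω (hω.trans_le (le_max_left _ _))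
  obtain ⟨φ, hφ, hφ'⟩ := exists_schwartz_of_even hv hc he
  have hrep := represents_testOp hB hK.tendsto_zero hK.locallyIntegrable hk hv.continuous hc hv0
    hφ m lam β
  have hmem : MemLp (fun ω => symbol m lam β k ω * v ω) 2 V.ν :=
    memLp_symbol_mul hk hv.continuous hc hv0 V.ν
  have hcov := hV.cov_eq φ φ
  rw [integral_mul_conj_self, V.norm_pair_sq hrep hmem] at hcov
  have hcov' := Complex.ofReal_injective hcov
  have hnoise := integral_noise_mul_self_le (P' := P') hlam hβ (W φ) (F φ)
  rw [hW φ φ, hF φ φ, integral_mul_self_eq hv.continuous hc he hφ hφ'] at hnoise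
  have hFb := integral_kernel_mul_conv_le hB hK.tendsto_zero hK.locallyIntegrable hK.symm hk hv
    hc he hv0 hφ hφ'
  have henergy : ∫ ω, ‖symbol m lam β k ω * v ω‖ ^ 2 ∂V.ν ≤ D * ∫ ω, v ω ^ 2 := by
    rw [hcov']
    refine hnoise.trans ?_
    have := mul_le_mul_of_nonneg_left hFb (by positivity : 0 ≤ 2 * β)
    rw [hD]
    linarith
  have hpt : ∀ ω, ω ^ 2 * v ω ^ 2 ≤ (m / 2)⁻¹ ^ 2 * ‖symbol m lam β k ω * v ω‖ ^ 2 := by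
    intro ω
    rcases lt_or_ge |ω| (max 1 (2 * (lam + β * M) / m)) with hω | hω
    · simp [hvA ω hω]
    · have h1 : 1 ≤ |ω| := (le_max_left _ _).trans hω
      have h2 : 2 * (lam + β * M) ≤ m * |ω| := by
        have := (le_max_right _ _).trans hω
        rwa [div_le_iff₀ hm, mul_comm |ω|] at this
      have h3 : m / 2 * |ω| ≤ ‖symbol m lam β k ω‖ := by
        have h4 : ‖(m * (Complex.I * ω) : ℂ)‖ = m * |ω| := by
          rw [norm_mul, norm_mul, Complex.norm_I, Complex.norm_real, Complex.norm_real,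
            Real.norm_of_nonneg hm.le, Real.norm_eq_abs, one_mul]
        have h5 : ‖(lam + β * k ω : ℂ)‖ ≤ lam + β * M := by
          refine (norm_add_le _ _).trans ?_
          rw [norm_mul, Complex.norm_real, Complex.norm_real, Real.norm_of_nonneg hlam,
            Real.norm_of_nonneg hβ.le]
          gcongr
          exact hk.norm_le ω h1
        have h6 := norm_sub_norm_le (m * (Complex.I * ω) : ℂ) (lam + β * k ω)
        have h7 : ‖symbol m lam β k ω‖ = ‖(m * (Complex.I * ω) : ℂ) - (lam + β * k ω)‖ := by
          rw [← norm_neg, symbol]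
          congr 1
          ring
        rw [h7]
        linarith
      have h8 : |ω| ≤ (m / 2)⁻¹ * ‖symbol m lam β k ω‖ := by
        rw [inv_mul_eq_div, le_div_iff₀ (by positivity)]
        linarith
      rw [norm_mul, mul_pow, Complex.norm_real, Real.norm_eq_abs, sq_abs, ← mul_assoc,
        ← mul_pow _ ‖symbol m lam β k ω‖, ← sq_abs ω]
      gcongr
  calc ∫ ω, ω ^ 2 * v ω ^ 2 ∂V.ν
      ≤ ∫ ω, (m / 2)⁻¹ ^ 2 * ‖symbol m lam β k ω * v ω‖ ^ 2 ∂V.ν :=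
        integral_mono_of_nonneg (Eventually.of_forall fun ω => by positivity)
          (((memLp_two_iff_integrable_sq_norm hmem.aestronglyMeasurable).1 hmem).const_mul _)
          (Eventually.of_forall hpt)
    _ = (m / 2)⁻¹ ^ 2 * ∫ ω, ‖symbol m lam β k ω * v ω‖ ^ 2 ∂V.ν := integral_const_mul _ _
    _ ≤ _ := by
      rw [mul_assoc]
      gcongr

/-- The spectral measure has a finite moment of order `1/2`; this is what makes the velocity an
ordinary process and gives it regularity. -/
theorem integrable_one_add_sq_rpow (hm : 0 < m) (hlam : 0 ≤ lam) (hβ : 0 < β)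
    (hK : IsAdmissibleKernel K) (hW : IsWhiteNoise W) (hF : HasCovarianceKernel K F)
    (hV : IsWeakSolution m lam β K W F V) :
    Integrable (fun ω : ℝ => (1 + ω ^ 2) ^ (1 / 4 : ℝ)) V.ν := by
  obtain ⟨C, A, hC, hA, hen⟩ := exists_integral_sq_mul_le hm hlam hβ hK hW hF hV
  have := V.isLocallyFiniteMeasure
  have hcont : Continuous fun ω : ℝ => (1 + ω ^ 2) ^ (1 / 4 : ℝ) := by
    refine Continuous.rpow_const (by fun_prop) fun ω => Or.inr (by norm_num)
  set S : Set ℝ := {ω | 2 * A ≤ |ω|} with hS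
  have hSm : MeasurableSet S := measurableSet_le measurable_const (by fun_prop)
  have hJ : Integrable fun ω : ℝ => (1 + ω ^ 2) ^ (-(3 / 4) : ℝ) := by
    have h := integrable_rpow_neg_one_add_norm_sq (E := ℝ) (μ := volume) (r := 3 / 2)
      (by simp; norm_num)
    refine h.congr (Eventually.of_forall fun ω => ?_)
    simp only [Real.norm_eq_abs, sq_abs]
    norm_num
  have hlow : IntegrableOn (fun ω : ℝ => (1 + ω ^ 2) ^ (1 / 4 : ℝ)) Sᶜ V.ν := by
    refine (hcont.integrableOn_Icc (a := -(2 * A)) (b := 2 * A)).mono_set fun ω hω => ?_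
    simp only [hS, mem_compl_iff, mem_ofPred_eq, not_le] at hω
    exact abs_le.1 hω.le
  have hhigh : IntegrableOn (fun ω : ℝ => (1 + ω ^ 2) ^ (1 / 4 : ℝ)) S V.ν := by
    refine (aecover_Icc (μ := V.ν.restrict S) (l := atTop) (a := fun n : ℕ => -((n : ℝ) + 1))
      (b := fun n : ℕ => (n : ℝ) + 1)
      (tendsto_neg_atTop_atBot.comp (tendsto_atTop_add_const_right _ _ tendsto_natCast_atTop_atTop))
      (tendsto_atTop_add_const_right _ _ tendsto_natCast_atTop_atTop)
      ).integrable_of_integral_bounded_of_nonneg_ae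
      -- the factor `2` is from `1 + ω² ≤ 2 ω²` for `1 ≤ |ω|`
      (2 * (C * ∫ ω, (1 + ω ^ 2) ^ (-(3 / 4) : ℝ)))
      (fun n => hcont.integrableOn_Icc.mono_measure Measure.restrict_le_self)
      (Eventually.of_forall fun ω => by positivity) (Eventually.of_forall fun n => ?_)
    have hn : (0 : ℝ) < (n : ℝ) + 1 := by positivity
    let b : ContDiffBump (0 : ℝ) := ⟨(n : ℝ) + 1, (n : ℝ) + 2, hn, by linarith⟩
    let a : ContDiffBump (0 : ℝ) := ⟨A, 2 * A, by linarith, by linarith⟩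
    -- even, smooth, equal to `(1 + ω²) ^ (-3/8)` on `2 A ≤ |ω| ≤ n + 1`
    let v : ℝ → ℝ := fun ω => b ω * ((1 - a ω) * (1 + ω ^ 2) ^ (-(3 / 8) : ℝ))
    have hvs : ContDiff ℝ ((⊤ : ℕ∞) : WithTop ℕ∞) v :=
      b.contDiff.mul ((contDiff_const.sub a.contDiff).mul
        (ContDiff.rpow_const_of_ne (by fun_prop) fun ω => by positivity))
    have hvc : HasCompactSupport v := b.hasCompactSupport.mul_right
    have hw : ∀ ω : ℝ, ((1 + ω ^ 2) ^ (-(3 / 8) : ℝ)) ^ 2 = (1 + ω ^ 2) ^ (-(3 / 4) : ℝ) := by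
      intro ω
      rw [← Real.rpow_mul_natCast (by positivity)]
      norm_num
    have hv1 : ∀ ω, v ω ^ 2 ≤ (1 + ω ^ 2) ^ (-(3 / 4) : ℝ) := by
      intro ω
      simp only [v]
      rw [mul_pow, mul_pow, hw]
      have h1 : b ω ^ 2 ≤ 1 := pow_le_one₀ (b.nonneg' ω) b.le_one
      have h2 : (1 - a ω) ^ 2 ≤ 1 :=
        pow_le_one₀ (by linarith [a.le_one (x := ω)]) (by linarith [a.nonneg' ω])
      have h3 : 0 ≤ (1 + ω ^ 2) ^ (-(3 / 4) : ℝ) := by positivity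
      calc b ω ^ 2 * ((1 - a ω) ^ 2 * (1 + ω ^ 2) ^ (-(3 / 4) : ℝ))
          ≤ 1 * (1 * (1 + ω ^ 2) ^ (-(3 / 4) : ℝ)) := by gcongr
        _ = _ := by ring
    have hen' := hen v hvs hvc (fun ω => by simp [v, b.neg, a.neg]) fun ω hω => by
      have : a ω = 1 := a.one_of_mem_closedBall (by simpa using hω.le)
      simp [v, this]
    have hlower : ∀ ω ∈ S ∩ Icc (-((n : ℝ) + 1)) ((n : ℝ) + 1),
        (1 + ω ^ 2) ^ (1 / 4 : ℝ) ≤ 2 * (ω ^ 2 * v ω ^ 2) := by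
      rintro ω ⟨hω, hωn⟩
      have hω : 2 * A ≤ |ω| := hω
      have h1 : b ω = 1 := b.one_of_mem_closedBall (by simpa using abs_le.2 hωn)
      have h2 : a ω = 0 := a.zero_of_le_dist (by simpa using hω)
      have h3 : v ω ^ 2 = (1 + ω ^ 2) ^ (-(3 / 4) : ℝ) := by
        simp only [v, h1, h2, sub_zero, one_mul, hw]
      have h4 : 1 + ω ^ 2 ≤ 2 * ω ^ 2 := by
        rw [← sq_abs]
        nlinarith
      rw [h3]
      calc (1 + ω ^ 2) ^ (1 / 4 : ℝ) = (1 + ω ^ 2) * (1 + ω ^ 2) ^ (-(3 / 4) : ℝ) := by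
            nth_rewrite 2 [← Real.rpow_one (1 + ω ^ 2)]
            rw [← Real.rpow_add (by positivity)]
            norm_num
        _ ≤ (2 * ω ^ 2) * (1 + ω ^ 2) ^ (-(3 / 4) : ℝ) := by gcongr
        _ = _ := by ring
    have hvi : Integrable (fun ω => 2 * (ω ^ 2 * v ω ^ 2)) V.ν := by
      have hvv : HasCompactSupport fun ω => v ω ^ 2 := by
        simp only [sq]
        exact hvc.mul_left
      have := hvs.continuous
      exact (Continuous.integrable_of_hasCompactSupport (by fun_prop) hvv.mul_left).const_mul 2
    rw [Measure.restrict_restrict measurableSet_Icc, inter_comm]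
    calc ∫ ω in S ∩ Icc (-((n : ℝ) + 1)) ((n : ℝ) + 1), (1 + ω ^ 2) ^ (1 / 4 : ℝ) ∂V.ν
        ≤ ∫ ω in S ∩ Icc (-((n : ℝ) + 1)) ((n : ℝ) + 1), 2 * (ω ^ 2 * v ω ^ 2) ∂V.ν :=
          setIntegral_mono_on (hcont.integrableOn_Icc.mono_set inter_subset_right)
            hvi.integrableOn (hSm.inter measurableSet_Icc) hlower
      _ ≤ ∫ ω, 2 * (ω ^ 2 * v ω ^ 2) ∂V.ν :=
          setIntegral_le_integral hvi (Eventually.of_forall fun ω => by positivity)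
      _ = 2 * ∫ ω, ω ^ 2 * v ω ^ 2 ∂V.ν := integral_const_mul _ _
      _ ≤ 2 * (C * ∫ ω, v ω ^ 2) := by gcongr
      _ ≤ _ := by
        have := integral_mono_of_nonneg (Eventually.of_forall fun ω => sq_nonneg (v ω)) hJ
          (Eventually.of_forall hv1)
        gcongr
  have := hlow.union hhigh
  rwa [compl_union_self, integrableOn_univ] at this

end Spectral

end GLE

namespace GLE

/-! ### Velocity and position -/

theorem represents_fourierD_delta (t : ℝ) :
    Represents (fourierD (TemperedDistribution.delta t)) fun ω => osc (-(t * ω)) := by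
  intro χ
  refine ⟨χ.integrable.bdd_mul (c := 1) (Continuous.aestronglyMeasurable (by fun_prop))
    (Eventually.of_forall fun ω => by simp), ?_⟩
  rw [fourierD_apply, TemperedDistribution.delta_apply, fourierS_eq_osc]
  refine integral_congr_ae (Eventually.of_forall fun ω => ?_)
  simp only
  rw [mul_comm, mul_comm t]

theorem represents_fourierD_intervalDist {t : ℝ} (ht : 0 ≤ t) :
    Represents (fourierD (ExtendedDistribution.intervalDist t))
      fun ω => ∫ s in (0 : ℝ)..t, osc (-(s * ω)) := by
  have hrep := represents_funDist_of_memLp_top (u := (Icc 0 t).indicator fun _ => (1 : ℂ)) (by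
    refine memLp_top_of_bound ((aestronglyMeasurable_const).indicator measurableSet_Icc) 1
      (Eventually.of_forall fun x => ?_)
    exact (norm_indicator_le_norm_self _ _).trans (by simp))
  intro χ
  have hcont : Continuous fun ω : ℝ => ∫ s in (0 : ℝ)..t, osc (-(s * ω)) :=
    intervalIntegral.continuous_parametric_intervalIntegral_of_continuous' (by fun_prop) _ _
  refine ⟨χ.integrable.bdd_mul (c := t) hcont.aestronglyMeasurable
    (Eventually.of_forall fun ω => ?_), ?_⟩
  · have := intervalIntegral.norm_integral_le_of_norm_le_const (a := 0) (b := t) (C := 1)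
      (f := fun s => osc (-(s * ω))) (by simp)
    simpa [abs_of_nonneg ht] using this
  · rw [fourierD_apply]
    refine ((hrep (fourierS χ)).2).trans ?_
    have h1 : ∀ s, (Icc 0 t).indicator (fun _ => (1 : ℂ)) s * fourierS χ s =
        (Icc 0 t).indicator (fun s => fourierS χ s) s := by
      intro s
      by_cases hs : s ∈ Icc 0 t <;> simp [hs]
    simp only [h1]
    rw [integral_indicator measurableSet_Icc, integral_Icc_eq_integral_Ioc]
    simp only [fourierS_eq_osc, intervalIntegral.integral_of_le ht]
    have h2 := integral_mul_integral_kernel_swap (μ := volume.restrict (Ioc 0 t)) (ρ := volume)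
      (f := χ) (g := fun _ => 1) χ.integrable (integrable_const _)
      (c := fun s ω => osc (-(s * ω))) (by fun_prop) (fun s ω => by simp)
    simp only [one_mul] at h2
    calc ∫ s in Ioc 0 t, ∫ ω, χ ω * osc (-(ω * s))
        = ∫ s in Ioc 0 t, ∫ ω, χ ω * osc (-(s * ω)) := by simp only [mul_comm]
      _ = ∫ ω, χ ω * ∫ s in Ioc 0 t, osc (-(s * ω)) := h2
      _ = _ := by simp only [mul_comm]

/-- Riemann sums of a continuous function converge to its integral. -/
theorem tendsto_riemannSum {E : Type*} [NormedAddCommGroup E] [NormedSpace ℝ E] [CompleteSpace E]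
    {f : ℝ → E} (hf : Continuous f) {t : ℝ} (ht : 0 ≤ t) :
    Tendsto (fun n : ℕ => (t / n) • ∑ j ∈ Finset.range n, f (j * (t / n))) atTop
      (𝓝 (∫ s in (0 : ℝ)..t, f s)) := by
  rw [Metric.tendsto_nhds]
  intro ε hε
  have huc := isCompact_Icc.uniformContinuousOn_of_continuous (hf.continuousOn (s := Icc 0 t))
  obtain ⟨δ, hδ, hd⟩ := Metric.uniformContinuousOn_iff.1 huc (ε / (t + 1)) (by positivity)
  have hsmall : ∀ᶠ n : ℕ in atTop, t / n < δ :=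
    (tendsto_const_div_atTop_nhds_zero_nat t).eventually (gt_mem_nhds hδ)
  filter_upwards [hsmall, eventually_gt_atTop 0] with n hn hn0
  have hn0' : (0 : ℝ) < n := by exact_mod_cast hn0
  set h := t / n with hh
  have hh0 : 0 ≤ h := by positivity
  have hnh : n * h = t := by rw [hh]; field_simp
  have hsum : ∑ j ∈ Finset.range n, ∫ s in ((j : ℝ) * h)..((j + 1 : ℕ) * h), f s =
      ∫ s in (0 : ℝ)..t, f s := by
    rw [intervalIntegral.sum_integral_adjacent_intervals (a := fun j : ℕ => (j : ℝ) * h)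
      fun j _ => hf.intervalIntegrable _ _]
    simp [hnh]
  have hconst : ∀ j : ℕ, ∫ _ in ((j : ℝ) * h)..((j + 1 : ℕ) * h), f (j * h) = h • f (j * h) := by
    intro j
    rw [intervalIntegral.integral_const]
    congr 1
    push_cast
    ring
  rw [dist_eq_norm, ← hsum, Finset.smul_sum, ← Finset.sum_sub_distrib]
  have hterm : ∀ j ∈ Finset.range n, ‖h • f (j * h) -
      ∫ s in ((j : ℝ) * h)..((j + 1 : ℕ) * h), f s‖ ≤ ε / (t + 1) * h := by
    intro j hj
    have hj1 : ((j + 1 : ℕ) : ℝ) ≤ n := by exact_mod_cast Finset.mem_range.1 hj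
    have hjh : ((j + 1 : ℕ) : ℝ) * h ≤ t := by
      rw [← hnh]
      gcongr
    have hlen : ((j + 1 : ℕ) : ℝ) * h - j * h = h := by
      push_cast
      ring
    rw [← hconst, ← intervalIntegral.integral_sub intervalIntegrable_const
      (hf.intervalIntegrable _ _)]
    refine (intervalIntegral.norm_integral_le_of_norm_le_const (C := ε / (t + 1))
      fun s hs => ?_).trans_eq (by rw [hlen, abs_of_nonneg hh0])
    rw [uIoc_of_le (by linarith)] at hs
    have hj0 : 0 ≤ (j : ℝ) * h := by positivity
    rw [← dist_eq_norm]
    refine (hd _ ⟨hj0, by linarith⟩ _ ⟨by linarith [hs.1], by linarith [hs.2]⟩ ?_).le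
    rw [Real.dist_eq, abs_sub_comm, abs_of_nonneg (by linarith [hs.1])]
    linarith [hs.2]
  refine (norm_sum_le_of_le _ hterm).trans_lt ?_
  rw [Finset.sum_const, Finset.card_range, nsmul_eq_mul, mul_left_comm, hnh, div_mul_eq_mul_div,
    div_lt_iff₀ (by positivity)]
  nlinarith

theorem norm_sq_eq_integral {α : Type*} [MeasurableSpace α] {μ : Measure α} (f : Lp ℂ 2 μ) :
    ‖f‖ ^ 2 = ∫ x, ‖f x‖ ^ 2 ∂μ := by
  have h := norm_toLp_sq (Lp.memLp f)
  rwa [Lp.toLp_coeFn] at h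

theorem coeFn_smul_sum {α ι : Type*} [MeasurableSpace α] {μ : Measure α} (c : ℝ) (s : Finset ι)
    (g : ι → Lp ℂ 2 μ) :
    ((c • ∑ j ∈ s, g j : Lp ℂ 2 μ) : α → ℂ) =ᵐ[μ] fun x => c • ∑ j ∈ s, g j x := by
  filter_upwards [Lp.coeFn_smul c (∑ j ∈ s, g j), Lp.coeFn_finsetSum s g] with x h1 h2
  rw [h1, Pi.smul_apply, h2, Finset.sum_apply]

theorem memLp_of_continuous_of_norm_le {ν : Measure ℝ} [IsFiniteMeasure ν] {f : ℝ → ℂ}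
    (hf : Continuous f) (C : ℝ) (hC : ∀ ω, ‖f ω‖ ≤ C) : MemLp f 2 ν :=
  MemLp.of_bound hf.aestronglyMeasurable C (Eventually.of_forall hC)

theorem memLp_osc (ν : Measure ℝ) [IsFiniteMeasure ν] (t : ℝ) :
    MemLp (fun ω => osc (t * ω)) 2 ν :=
  memLp_of_continuous_of_norm_le (by fun_prop) 1 (by simp)

/-- The character `ω ↦ exp (i t ω)` as an element of `L²(ν)`. -/
noncomputable def charLp (ν : Measure ℝ) [IsFiniteMeasure ν] (t : ℝ) : Lp ℂ 2 ν :=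
  (memLp_osc ν t).toLp _

/-- Interpolation between the bounds `|t - s| |ω|` and `2` for the difference of two characters. -/
theorem norm_osc_sub_sq_le (t s ω : ℝ) :
    ‖osc (t * ω) - osc (s * ω)‖ ^ 2 ≤ 4 * |t - s| ^ (1 / 2 : ℝ) * (1 + ω ^ 2) ^ (1 / 4 : ℝ) := by
  have h1 : ‖osc (t * ω) - osc (s * ω)‖ ≤ |t - s| * |ω| := by
    have e : osc (t * ω) - osc (s * ω) = osc (s * ω) * (osc ((t - s) * ω) - 1) := by
      rw [mul_sub, ← osc_add, mul_one]
      ring_nf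
    rw [e, norm_mul, norm_osc, one_mul, ← abs_mul]
    exact norm_osc_sub_one_le _
  have h2 : ‖osc (t * ω) - osc (s * ω)‖ ≤ 2 := by
    refine (norm_sub_le _ _).trans ?_
    rw [norm_osc, norm_osc]
    norm_num
  set a := ‖osc (t * ω) - osc (s * ω)‖
  have ha : 0 ≤ a := norm_nonneg _
  have h3 : a ^ 2 ≤ 4 * (|t - s| * |ω|) ^ (1 / 2 : ℝ) := by
    rcases le_total (|t - s| * |ω|) 1 with hx | hx
    · have h4 : (|t - s| * |ω|) ^ 2 ≤ (|t - s| * |ω|) ^ (1 / 2 : ℝ) := by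
        rw [← Real.rpow_natCast]
        exact Real.rpow_le_rpow_of_exponent_ge' (by positivity) hx (by norm_num) (by norm_num)
      have h5 : a ^ 2 ≤ (|t - s| * |ω|) ^ 2 := by gcongr
      have h6 : 0 ≤ (|t - s| * |ω|) ^ (1 / 2 : ℝ) := by positivity
      linarith
    · have := Real.one_le_rpow hx (by norm_num : (0 : ℝ) ≤ 1 / 2)
      nlinarith
  refine h3.trans ?_
  rw [Real.mul_rpow (by positivity) (by positivity), mul_assoc]
  gcongr
  calc |ω| ^ (1 / 2 : ℝ) = (|ω| ^ 2) ^ (1 / 4 : ℝ) := by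
        rw [← Real.rpow_natCast_mul (by positivity)]
        norm_num
    _ ≤ _ := by
        gcongr
        rw [sq_abs]
        linarith

theorem norm_charLp_sub_sq_le {ν : Measure ℝ} [IsFiniteMeasure ν]
    (hν : Integrable (fun ω : ℝ => (1 + ω ^ 2) ^ (1 / 4 : ℝ)) ν) (t s : ℝ) :
    ‖charLp ν t - charLp ν s‖ ^ 2 ≤
      4 * (∫ ω, (1 + ω ^ 2) ^ (1 / 4 : ℝ) ∂ν) * |t - s| ^ (1 / 2 : ℝ) := by
  have h1 : charLp ν t - charLp ν s = ((memLp_osc ν t).sub (memLp_osc ν s)).toLp _ := rfl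
  rw [h1, norm_toLp_sq]
  calc ∫ ω, ‖((fun ω => osc (t * ω)) - fun ω => osc (s * ω)) ω‖ ^ 2 ∂ν
      ≤ ∫ ω, 4 * |t - s| ^ (1 / 2 : ℝ) * (1 + ω ^ 2) ^ (1 / 4 : ℝ) ∂ν :=
        integral_mono_of_nonneg (Eventually.of_forall fun ω => by positivity)
          (hν.const_mul _) (Eventually.of_forall fun ω => norm_osc_sub_sq_le t s ω)
    _ = _ := by
        rw [integral_const_mul]
        ring

theorem inner_charLp {ν : Measure ℝ} [IsFiniteMeasure ν] (s t : ℝ) :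
    inner ℂ (charLp ν s) (charLp ν t) = ∫ ω, osc ((t - s) * ω) ∂ν := by
  rw [L2.inner_def]
  refine integral_congr_ae ?_
  filter_upwards [(memLp_osc ν s).coeFn_toLp, (memLp_osc ν t).coeFn_toLp] with ω h1 h2
  simp only [charLp]
  rw [h1, h2, RCLike.inner_apply, conj_osc, ← osc_add]
  ring_nf

namespace ExtendedDistribution

variable {Ω : Type*} [MeasurableSpace Ω] {P : Measure Ω} {V : ExtendedDistribution P}
  [IsFiniteMeasure V.ν]

theorem delta_mem_dom (t : ℝ) : TemperedDistribution.delta t ∈ V.Dom :=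
  ⟨_, represents_fourierD_delta t,
    memLp_of_continuous_of_norm_le (by fun_prop) 1 (by simp)⟩

/-- The spectral representation of the velocity. -/
theorem velocity_eq (t : ℝ) : V.velocity t = V.ξ.integral (charLp V.ν t) := by
  rw [velocity, V.pair_eq (represents_fourierD_delta t)
    (memLp_of_continuous_of_norm_le (by fun_prop) 1 (by simp))]
  congr 1
  refine (MemLp.toLp_eq_toLp_iff _ _).2 (Eventually.of_forall fun ω => ?_)
  show conj (osc (-(t * ω))) = osc (t * ω)
  rw [conj_osc, neg_neg]

theorem velocity_sub_eq (t s : ℝ) :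
    V.velocity t - V.velocity s = V.ξ.integral (charLp V.ν t - charLp V.ν s) := by
  rw [velocity_eq, velocity_eq, map_sub]

theorem continuous_integral_osc (t : ℝ) :
    Continuous fun ω : ℝ => ∫ s in (0 : ℝ)..t, osc (s * ω) :=
  intervalIntegral.continuous_parametric_intervalIntegral_of_continuous' (by fun_prop) _ _

theorem norm_integral_osc_le {t : ℝ} (ht : 0 ≤ t) (ω : ℝ) :
    ‖∫ s in (0 : ℝ)..t, osc (s * ω)‖ ≤ t := by
  have := intervalIntegral.norm_integral_le_of_norm_le_const (a := 0) (b := t) (C := 1)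
    (f := fun s => osc (s * ω)) (by simp)
  simpa [abs_of_nonneg ht] using this

theorem memLp_integral_osc {t : ℝ} (ht : 0 ≤ t) (ν : Measure ℝ) [IsFiniteMeasure ν] :
    MemLp (fun ω : ℝ => ∫ s in (0 : ℝ)..t, osc (s * ω)) 2 ν :=
  memLp_of_continuous_of_norm_le (continuous_integral_osc t) t (norm_integral_osc_le ht)

theorem conj_integral_osc (t ω : ℝ) :
    conj (∫ s in (0 : ℝ)..t, osc (s * ω)) = ∫ s in (0 : ℝ)..t, osc (-(s * ω)) := by
  rw [intervalIntegral, intervalIntegral, map_sub, ← integral_conj, ← integral_conj]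
  simp only [conj_osc]

theorem memLp_integral_osc_neg {t : ℝ} (ht : 0 ≤ t) (ν : Measure ℝ) [IsFiniteMeasure ν] :
    MemLp (fun ω : ℝ => ∫ s in (0 : ℝ)..t, osc (-(s * ω))) 2 ν := by
  simp only [← conj_integral_osc]
  exact (memLp_integral_osc ht ν).star

theorem intervalDist_mem_dom {t : ℝ} (ht : 0 ≤ t) : intervalDist t ∈ V.Dom :=
  ⟨_, represents_fourierD_intervalDist ht, memLp_integral_osc_neg ht V.ν⟩

/-- The position has the spectral representation obtained by integrating that of the velocity. -/
theorem position_eq {t : ℝ} (ht : 0 ≤ t) :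
    V.position t = V.ξ.integral ((memLp_integral_osc ht V.ν).toLp _) := by
  rw [position, V.pair_eq (represents_fourierD_intervalDist ht) (memLp_integral_osc_neg ht V.ν)]
  congr 1
  refine (MemLp.toLp_eq_toLp_iff _ _).2 (Eventually.of_forall fun ω => ?_)
  show conj (∫ s in (0 : ℝ)..t, osc (-(s * ω))) = ∫ s in (0 : ℝ)..t, osc (s * ω)
  rw [← conj_integral_osc, Complex.conj_conj]

/-- The Riemann sums of the velocity converge to the position in mean square. -/
theorem tendsto_riemannSum_velocity {t : ℝ} (ht : 0 ≤ t) :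
    Tendsto (fun n : ℕ => (t / n) • ∑ j ∈ Finset.range n, V.velocity (j * (t / n))) atTop
      (𝓝 (V.position t)) := by
  have hS : Tendsto (fun n : ℕ => (t / n) • ∑ j ∈ Finset.range n, charLp V.ν (j * (t / n)))
      atTop (𝓝 ((memLp_integral_osc ht V.ν).toLp _)) := by
    rw [tendsto_iff_norm_sub_tendsto_zero]
    have hsq : Tendsto (fun n : ℕ => ‖(t / n) • ∑ j ∈ Finset.range n,
        charLp V.ν (j * (t / n)) - (memLp_integral_osc ht V.ν).toLp _‖ ^ 2) atTop (𝓝 0) := by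
      have heq : ∀ n : ℕ, ‖(t / n) • ∑ j ∈ Finset.range n,
          charLp V.ν (j * (t / n)) - (memLp_integral_osc ht V.ν).toLp _‖ ^ 2 =
          ∫ ω, ‖(t / n) • ∑ j ∈ Finset.range n, osc (j * (t / n) * ω) -
            ∫ s in (0 : ℝ)..t, osc (s * ω)‖ ^ 2 ∂V.ν := by
        intro n
        rw [norm_sq_eq_integral]
        have hc : ∀ᵐ ω ∂V.ν, ∀ j : ℕ, charLp V.ν (j * (t / n)) ω = osc (j * (t / n) * ω) :=
          ae_all_iff.2 fun j => (memLp_osc V.ν (j * (t / n))).coeFn_toLp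
        refine integral_congr_ae ?_
        filter_upwards [Lp.coeFn_sub ((t / n) • ∑ j ∈ Finset.range n, charLp V.ν (j * (t / n)))
          ((memLp_integral_osc ht V.ν).toLp _),
          coeFn_smul_sum (t / n) (Finset.range n) fun j => charLp V.ν (j * (t / n)), hc,
          (memLp_integral_osc ht V.ν).coeFn_toLp] with ω h1 h2 h3 h4
        rw [h1, Pi.sub_apply, h2, h4]
        simp only [h3]
      simp only [heq]
      rw [show 𝓝 (0 : ℝ) = 𝓝 (∫ _ : ℝ, (0 : ℝ) ∂V.ν) by simp]
      refine tendsto_integral_of_dominated_convergence (fun _ => (t + t) ^ 2)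
        (fun n => Continuous.aestronglyMeasurable ?_) (integrable_const _)
        (fun n => Eventually.of_forall fun ω => ?_) (Eventually.of_forall fun ω => ?_)
      · have := continuous_integral_osc t
        fun_prop
      · rw [Real.norm_of_nonneg (by positivity)]
        gcongr
        refine (norm_sub_le _ _).trans (add_le_add ?_ (norm_integral_osc_le ht ω))
        rw [norm_smul, Real.norm_of_nonneg (by positivity)]
        refine (mul_le_mul_of_nonneg_left (norm_sum_le _ _) (by positivity)).trans ?_
        simp only [norm_osc, Finset.sum_const, Finset.card_range, nsmul_eq_mul, mul_one]
        rcases Nat.eq_zero_or_pos n with rfl | hn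
        · simpa using ht
        · have : (n : ℝ) ≠ 0 := by positivity
          rw [div_mul_cancel₀ _ this]
      · have h1 := tendsto_riemannSum (f := fun s => osc (s * ω)) (by fun_prop) ht
        have h2 := (h1.sub_const (∫ s in (0 : ℝ)..t, osc (s * ω))).norm.pow 2
        simpa using h2
    have := hsq.sqrt
    simpa using this
  rw [position_eq ht]
  have := (V.ξ.integral.continuous.tendsto _).comp hS
  refine this.congr fun n => ?_
  simp only [Function.comp_apply, velocity_eq]
  rw [ContinuousLinearMap.map_smul_of_tower, map_sum]

/-- The position is the integral of a continuous version of the velocity. -/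
theorem integral_eq_position {η : ℝ → Ω → ℂ} (hη : ∀ t, η t =ᵐ[P] V.velocity t)
    (hc : ∀ᵐ x ∂P, Continuous fun t => η t x) {t : ℝ} (ht : 0 ≤ t) :
    (fun x => ∫ s in (0 : ℝ)..t, η s x) =ᵐ[P] V.position t := by
  have h1 := tendstoInMeasure_of_tendsto_Lp (tendsto_riemannSum_velocity (V := V) ht)
  obtain ⟨ns, hns, hsub⟩ := h1.exists_seq_tendsto_ae
  have h2 : ∀ᵐ x ∂P, ∀ n : ℕ, ((t / n) • ∑ j ∈ Finset.range n, V.velocity (j * (t / n)) :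
      Lp ℂ 2 P) x = (t / n) • ∑ j ∈ Finset.range n, V.velocity (j * (t / n)) x :=
    ae_all_iff.2 fun n => coeFn_smul_sum _ _ _
  have h3 : ∀ᵐ x ∂P, ∀ n j : ℕ, η (j * (t / n)) x = V.velocity (j * (t / n)) x :=
    ae_all_iff.2 fun n => ae_all_iff.2 fun j => hη _
  filter_upwards [hsub, h2, h3, hc] with x hx1 hx2 hx3 hx4
  refine tendsto_nhds_unique ((tendsto_riemannSum hx4 ht).comp hns.tendsto_atTop) ?_
  refine hx1.congr fun i => ?_
  simp only [Function.comp_apply, hx2, hx3]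

theorem isStationaryProcess_velocity [IsProbabilityMeasure P]
    (hν : Integrable (fun ω : ℝ => (1 + ω ^ 2) ^ (1 / 4 : ℝ)) V.ν) :
    IsStationaryProcess (fun t x => V.velocity t x) P where
  memLp t := Lp.memLp _
  continuous t := by
    have heq : ∀ h : ℝ, ∫ x, ‖V.velocity (t + h) x - V.velocity t x‖ ^ 2 ∂P =
        ‖charLp V.ν (t + h) - charLp V.ν t‖ ^ 2 := by
      intro h
      rw [← V.ξ.norm_integral, ← velocity_sub_eq, norm_sq_eq_integral]
      refine integral_congr_ae ?_
      filter_upwards [Lp.coeFn_sub (V.velocity (t + h)) (V.velocity t)] with x hx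
      rw [hx, Pi.sub_apply]
    simp only [heq]
    refine squeeze_zero (fun h => by positivity) (fun h => norm_charLp_sub_sq_le hν _ _) ?_
    have hcont : Continuous fun h : ℝ =>
        4 * (∫ ω, (1 + ω ^ 2) ^ (1 / 4 : ℝ) ∂V.ν) * |t + h - t| ^ (1 / 2 : ℝ) :=
      continuous_const.mul (Continuous.rpow_const (by fun_prop) fun _ => Or.inr (by norm_num))
    have := hcont.tendsto 0
    simpa using this
  mean := ⟨0, fun t => by rw [velocity_eq]; exact V.ξ.integral_integral_eq_zero _⟩
  cov := by
    refine ⟨fun τ => ∫ ω, osc (τ * ω) ∂V.ν, fun t s => ?_⟩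
    change _ = ∫ ω, osc ((t - s) * ω) ∂V.ν
    rw [← inner_charLp, ← V.ξ.inner_integral, ← velocity_eq, ← velocity_eq, L2.inner_def]
    rfl

/-- The velocity satisfies the Kolmogorov condition: its increments have variance of order
`|t - s| ^ (1/2)`, hence, being Gaussian, eighth moments of order `|t - s| ^ 2`. -/
theorem isKolmogorovProcess_velocity [IsProbabilityMeasure P]
    (hν : Integrable (fun ω : ℝ => (1 + ω ^ 2) ^ (1 / 4 : ℝ)) V.ν) :
    ∃ M : NNReal, IsKolmogorovProcess (fun t x => V.velocity t x) P 8 2 M := by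
  set c := ∫⁻ y, ‖y‖ₑ ^ (8 : ℝ) ∂(gaussianReal 0 1) with hc
  have hcfin : c ≠ ∞ := lintegral_enorm_rpow_gaussianReal_ne_top (by norm_num)
  set I := 4 * ∫ ω, (1 + ω ^ 2) ^ (1 / 4 : ℝ) ∂V.ν with hI
  have hfin : (2 : ℝ≥0∞) ^ (8 : ℝ) * c * ENNReal.ofReal I ^ 4 ≠ ∞ := by finiteness
  refine ⟨((2 : ℝ≥0∞) ^ (8 : ℝ) * c * ENNReal.ofReal I ^ 4).toNNReal,
    .mk_of_secondCountableTopology (fun t => (Lp.stronglyMeasurable _).measurable)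
      (fun s t => ?_) (by norm_num) (by norm_num)⟩
  rw [ENNReal.coe_toNNReal hfin]
  have h1 : ∫⁻ x, edist (V.velocity s x) (V.velocity t x) ^ (8 : ℝ) ∂P =
      ∫⁻ x, ‖V.ξ.integral (charLp V.ν s - charLp V.ν t) x‖ₑ ^ (8 : ℝ) ∂P := by
    rw [← velocity_sub_eq]
    refine lintegral_congr_ae ?_
    filter_upwards [Lp.coeFn_sub (V.velocity s) (V.velocity t)] with x hx
    rw [hx, Pi.sub_apply, edist_eq_enorm_sub]
  rw [h1]
  refine (V.ξ.lintegral_enorm_integral_rpow_le _ (by norm_num)).trans ?_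
  rw [mul_assoc _ (ENNReal.ofReal I ^ 4)]
  gcongr
  have h2 := norm_charLp_sub_sq_le hν s t
  rw [← hI] at h2
  calc ‖charLp V.ν s - charLp V.ν t‖ₑ ^ (8 : ℝ)
      = (ENNReal.ofReal (‖charLp V.ν s - charLp V.ν t‖ ^ 2)) ^ 4 := by
        rw [ENNReal.ofReal_pow (norm_nonneg _), ofReal_norm, ← pow_mul, ← ENNReal.rpow_natCast]
        norm_num
    _ ≤ (ENNReal.ofReal (I * |s - t| ^ (1 / 2 : ℝ))) ^ 4 := by gcongr
    _ = ENNReal.ofReal I ^ 4 * edist s t ^ (2 : ℝ) := by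
        rw [ENNReal.ofReal_mul (by positivity), mul_pow, edist_dist, Real.dist_eq,
          ← ENNReal.ofReal_rpow_of_nonneg (abs_nonneg _) (by norm_num), ← ENNReal.rpow_natCast,
          ← ENNReal.rpow_natCast, ← ENNReal.rpow_mul]
        norm_num

end ExtendedDistribution

end GLE

theorem mainTheorem9 {Ω Ω' : Type*} [MeasurableSpace Ω] [MeasurableSpace Ω']
    {P : Measure Ω} [IsProbabilityMeasure P] {P' : Measure Ω'} [IsProbabilityMeasure P']
    (m lam β : ℝ) (hm : 0 < m) (hlam : 0 ≤ lam) (hβ : 0 < β)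
    (K : ℝ → ℝ) (hK : GLE.IsAdmissibleKernel K)
    (W F : 𝓢(ℝ, ℝ) →ₗ[ℝ] Lp ℝ 2 P')
    (hW : GLE.IsWhiteNoise W) (hF : GLE.HasCovarianceKernel K F)
    (V : GLE.ExtendedDistribution P) (hV : GLE.IsWeakSolution m lam β K W F V) :
    (∀ t : ℝ, TemperedDistribution.delta t ∈ V.Dom) ∧
    GLE.IsStationaryProcess (fun t x => V.velocity t x) P ∧
    (∀ t : ℝ, ∫ x, V.velocity t x ∂P = 0) ∧
    IsGaussianProcess (fun (t : ℝ) (x : Ω) => V.velocity t x) P ∧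
    (∀ t : ℝ, 0 ≤ t → GLE.ExtendedDistribution.intervalDist t ∈ V.Dom) ∧
    ∃ η : ℝ → Ω → ℂ,
      (∀ t : ℝ, Measurable (η t)) ∧
      (∀ t : ℝ, η t =ᵐ[P] V.velocity t) ∧
      (∀ᵐ x ∂P, Continuous fun t : ℝ => η t x) ∧
      (∀ t : ℝ, 0 ≤ t → (fun x => ∫ s in (0 : ℝ)..t, η s x) =ᵐ[P] V.position t) ∧
      (∀ᵐ x ∂P, ∀ t : ℝ, HasDerivAt (fun u : ℝ => ∫ s in (0 : ℝ)..u, η s x) (η t x) t) := by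
  have hν := GLE.integrable_one_add_sq_rpow hm hlam hβ hK hW hF hV
  have hfin : IsFiniteMeasure V.ν := by
    have h1 : Integrable (fun _ : ℝ => (1 : ℝ)) V.ν := by
      refine hν.mono' aestronglyMeasurable_const (Eventually.of_forall fun ω => ?_)
      rw [norm_one]
      exact Real.one_le_rpow (by nlinarith [sq_nonneg ω]) (by norm_num)
    rcases integrable_const_iff.1 h1 with h | h
    · norm_num at h
    · exact h
  obtain ⟨M, hM⟩ := GLE.ExtendedDistribution.isKolmogorovProcess_velocity hν
  obtain ⟨η, hηm, hη, hηc⟩ := GLE.exists_continuous_modification hM (by norm_num)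
  refine ⟨fun t => GLE.ExtendedDistribution.delta_mem_dom t,
    GLE.ExtendedDistribution.isStationaryProcess_velocity hν, fun t => ?_, ?_,
    fun t ht => GLE.ExtendedDistribution.intervalDist_mem_dom ht, η, hηm, hη, hηc,
    fun t ht => GLE.ExtendedDistribution.integral_eq_position hη hηc ht, ?_⟩
  · rw [GLE.ExtendedDistribution.velocity_eq]
    exact V.ξ.integral_integral_eq_zero _
  · simp only [GLE.ExtendedDistribution.velocity_eq]
    exact V.ξ.isGaussianProcess_integral.comp_right fun t => GLE.charLp V.ν t
  · filter_upwards [hηc] with x hx t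
    exact hx.integral_hasStrictDerivAt 0 t |>.hasDerivAt
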